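/- Let $\{\mu_m\}_{m\in\mathbb N}$ be a sequence of probability distributions (Borel probability measures) on $\mathbb R$, and let $\varphi_m(t)=\int_{\mathbb R}e^{itx}\,\mu_m(dx)$ be the corresponding characteristic functions. Then $\{\mu_m\}$ is computable if and only if $\{\varphi_m\}$ is a computable sequence of functions. Here the notions of computability are those of Pour-El and Richards, all indices and arguments of recursive functions being natural numbers: - A (multi-)sequence of rationals is *recursive* if it has the form $r_i=(-1)^{s(i)}a(i)/b(i)$ with recursive $s,a,b$ and $b(i)\ne 0$ for all $i$. A sequence of complex numbers is recursive if its real and imaginary parts are recursive sequences of rationals. - A (multi-)sequence $\{x_i\}$ of real (complex) numbers is *computable* if there are a recursive sequence $\{r_{i,k}\}$ of rationals (of complex numbers with rational real and imaginary parts) and a recursive function $e(i,N)$ such that $k\ge e(i,N)$ implies $|r_{i,k}-x_i|\le 2^{-N}$. - A sequence $\{f_n\}$ of real- or complex-valued functions on $\mathbb R$ is *computable* if (i) the double sequence $\{f_n(x_m)\}$ is computable for every computable sequence of reals $\{x_m\}$, and (ii) there is a recursive function $\alpha(n,L,k)$ such that $|x-y|<2^{-\alpha(n,L,k)}$ and $|x|,|y|\le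 L$ imply $|f_n(x)-f_n(y)|<2^{-k}$. - $\{\mu_m\}$ is *computable* if the double sequence of reals $\{\int_{\mathbb R}f_n\,d\mu_m\}$ is computable for every computable sequence $\{f_n\}$ of real-valued functions on $\mathbb R$ for which there is a recursive function $L(n)$ such that $f_n(x)=0$ whenever $|x|\ge L(n)$. -/

import Mathlib

open MeasureTheory

namespace PourElRichards

variable {ι : Type*} [Primcodable ι]

/-- A recursive (multi-)sequence of rational numbers `r i = (-1) ^ s i * a i / b i`, where `s`, `a`
and `b` are recursive and `b` has no zeros. The index type is `ℕ`, `ℕ × ℕ`, `(ℕ × ℕ) × ℕ`, ... -/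
def RecursiveRatSeq (r : ι → ℚ) : Prop :=
  ∃ s a b : ι → ℕ, Computable s ∧ Computable a ∧ Computable b ∧
    ∀ i, b i ≠ 0 ∧ r i = (-1) ^ s i * (a i : ℚ) / (b i : ℚ)

/-- A computable (multi-)sequence of reals: the limit of a recursive sequence of rationals `r (i, k)`
as `k → ∞`, the convergence being effective in `k` and `i`. -/
def ComputableRealSeq (x : ι → ℝ) : Prop :=
  ∃ r : ι × ℕ → ℚ, RecursiveRatSeq r ∧
    ∃ e : ι × ℕ → ℕ, Computable e ∧
      ∀ i N k, e (i, N) ≤ k → |(r (i, k) : ℝ) - x i| ≤ (2 : ℝ)⁻¹ ^ N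

/-- A computable (multi-)sequence of complex numbers: the effective limit of a recursive sequence
`r (i, k) + s (i, k) * I` of complex numbers with rational real and imaginary parts. -/
def ComputableComplexSeq (z : ι → ℂ) : Prop :=
  ∃ r s : ι × ℕ → ℚ, RecursiveRatSeq r ∧ RecursiveRatSeq s ∧
    ∃ e : ι × ℕ → ℕ, Computable e ∧
      ∀ i N k, e (i, N) ≤ k →
        ‖((r (i, k) : ℂ) + (s (i, k) : ℂ) * Complex.I) - z i‖ ≤ (2 : ℝ)⁻¹ ^ N

/-- Effective continuity of a sequence of functions on `ℝ`: there is a recursive modulus of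
continuity `α (n, L, k)` for `f n` on `[-L, L]`. -/
def EffectivelyContinuous {E : Type*} [NormedAddCommGroup E] (f : ℕ → ℝ → E) : Prop :=
  ∃ α : ℕ × ℕ × ℕ → ℕ, Computable α ∧
    ∀ (n L k : ℕ) (x y : ℝ), |x - y| < (2 : ℝ)⁻¹ ^ α (n, L, k) → |x| ≤ L → |y| ≤ L →
      ‖f n x - f n y‖ < (2 : ℝ)⁻¹ ^ k

/-- A computable sequence of real-valued functions on `ℝ`: sequentially computable and effectively
continuous. -/
structure ComputableRealFunSeq (f : ℕ → ℝ → ℝ) : Prop where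
  sequentially_computable : ∀ x : ℕ → ℝ, ComputableRealSeq x →
    ComputableRealSeq (fun p : ℕ × ℕ => f p.1 (x p.2))
  effectively_continuous : EffectivelyContinuous f

/-- A computable sequence of complex-valued functions on `ℝ`: sequentially computable and
effectively continuous. -/
structure ComputableComplexFunSeq (f : ℕ → ℝ → ℂ) : Prop where
  sequentially_computable : ∀ x : ℕ → ℝ, ComputableRealSeq x →
    ComputableComplexSeq (fun p : ℕ × ℕ => f p.1 (x p.2))
  effectively_continuous : EffectivelyContinuous f

/-- `f` is a computable sequence of functions with compact support `L`, where `L` is recursive and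
`f n` vanishes at all `x` with `|x| ≥ L n`. -/
def ComputableWithCompactSupport (f : ℕ → ℝ → ℝ) (L : ℕ → ℕ) : Prop :=
  ComputableRealFunSeq f ∧ Computable L ∧ ∀ (n : ℕ) (x : ℝ), (L n : ℝ) ≤ |x| → f n x = 0

/-- A computable sequence of probability distributions: the double sequence of the integrals of
`f n` with respect to `μ m` is computable for every computable sequence `f` of functions with
compact support. -/
def ComputableDistributionSeq (μ : ℕ → ProbabilityMeasure ℝ) : Prop :=
  ∀ (f : ℕ → ℝ → ℝ) (L : ℕ → ℕ), ComputableWithCompactSupport f L →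
    ComputableRealSeq (fun p : ℕ × ℕ => ∫ x, f p.2 x ∂(μ p.1 : Measure ℝ))

end PourElRichards

/-!
Continuous cutoffs of `[-n, n]` are computable functions with compact support, so computability of
`μ` yields numbers `T (m, k)` such that `μ m` gives mass at most `2⁻ᵏ` to `|x| > T (m, k)`. Bounded
effectively continuous functions such as `cos (t x)` and `sin (t x)` can then be integrated by
cutting them off, and the same bound on the tails gives the modulus of continuity of the
characteristic functions.

Conversely, the modulus of continuity of the characteristic functions at `0` bounds the tails of
`μ m`. A compactly supported function is uniformly close to a piecewise linear interpolant, which is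
a combination of triangle functions. On a large interval a triangle function agrees with a periodic
triangle wave, whose Fourier partial sums converge uniformly at an explicit rate, and the integral
of such a partial sum is a finite combination of values of the characteristic function.
-/

namespace PourElRichards

section Computable

attribute [fun_prop] Computable
attribute [fun_prop] Computable.id Computable.const Computable.comp Computable.fst Computable.snd
  Computable.pair

variable {α β γ ι : Type*} [Primcodable α] [Primcodable β] [Primcodable γ] [Primcodable ι]

@[fun_prop]
theorem computable_fst {f : α → β × γ} (hf : Computable f) : Computable fun i => (f i).1 :=
  Computable.fst.comp hf

@[fun_prop]
theorem computable_snd {f : α → β × γ} (hf : Computable f) : Computable fun i => (f i).2 :=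
  Computable.snd.comp hf

variable {f g : ι → ℕ}

@[fun_prop]
theorem computable_add (hf : Computable f) (hg : Computable g) : Computable fun i => f i + g i :=
  Primrec.nat_add.to_comp.comp hf hg

@[fun_prop]
theorem computable_sub (hf : Computable f) (hg : Computable g) : Computable fun i => f i - g i :=
  Primrec.nat_sub.to_comp.comp hf hg

@[fun_prop]
theorem computable_mul (hf : Computable f) (hg : Computable g) : Computable fun i => f i * g i :=
  Primrec.nat_mul.to_comp.comp hf hg

@[fun_prop]
theorem computable_div (hf : Computable f) (hg : Computable g) : Computable fun i => f i / g i :=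
  Primrec.nat_div.to_comp.comp hf hg

@[fun_prop]
theorem computable_mod (hf : Computable f) (hg : Computable g) : Computable fun i => f i % g i :=
  Primrec.nat_mod.to_comp.comp hf hg

@[fun_prop]
theorem computable_pow (hf : Computable f) (hg : Computable g) : Computable fun i => f i ^ g i :=
  (Primrec₂.unpaired'.1 Nat.Primrec.pow).to_comp.comp hf hg

@[fun_prop]
theorem computable_unpair (hf : Computable f) : Computable fun i => Nat.unpair (f i) :=
  Computable.unpair.comp hf

@[fun_prop]
theorem computable_pair (hf : Computable f) (hg : Computable g) :
    Computable fun i => Nat.pair (f i) (g i) :=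
  Primrec₂.natPair.to_comp.comp hf hg

@[fun_prop]
theorem computable_sum_range {F : ι → ℕ → ℕ} (hF : Computable fun p : ι × ℕ => F p.1 p.2)
    (hf : Computable f) : Computable fun i => ∑ j ∈ Finset.range (f i), F i j := by
  have h : Computable fun i => (Nat.rec 0 (fun j s => s + F i j) (f i) : ℕ) :=
    Computable.nat_rec (h := fun i p => p.2 + F i p.1) hf (Computable.const 0)
      (Computable₂.mk (by fun_prop))
  refine h.of_eq fun i => ?_
  induction f i with
  | zero => rfl
  | succ n ih => rw [Finset.sum_range_succ, ← ih]

@[fun_prop]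
theorem computable_factorial (hf : Computable f) : Computable fun i => (f i).factorial := by
  have h : Computable fun i => (Nat.rec 1 (fun j s => (j + 1) * s) (f i) : ℕ) :=
    Computable.nat_rec (h := fun _ p => (p.1 + 1) * p.2) hf (Computable.const 1)
      (Computable₂.mk (by fun_prop))
  refine h.of_eq fun i => ?_
  induction f i with
  | zero => rfl
  | succ n ih => rw [Nat.factorial_succ, ← ih]

theorem exists_computable_forall_lt {f g : ι × ℕ → ℕ} (hf : Computable f) (hg : Computable g)
    (h : ∀ i, ∃ n, f (i, n) < g (i, n)) :
    ∃ c : ι → ℕ, Computable c ∧ ∀ i, f (i, c i) < g (i, c i) := by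
  have hp : Computable₂ fun (i : ι) (n : ℕ) => decide (f (i, n) < g (i, n)) :=
    Primrec.nat_lt.decide.to_comp.comp hf hg
  have hdom : ∀ i, (Nat.rfind fun n => Part.some (decide (f (i, n) < g (i, n)))).Dom := fun i => by
    obtain ⟨n, hn⟩ := h i
    exact Nat.rfind_dom.2 ⟨n, by simpa using hn, fun _ => trivial⟩
  refine ⟨fun i => (Nat.rfind fun n => Part.some (decide (f (i, n) < g (i, n)))).get (hdom i),
    (Partrec.rfind hp.partrec₂).of_eq_tot fun _ => Part.get_mem _, fun i => ?_⟩
  simpa using Nat.rfind_spec (Part.get_mem (hdom i))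

end Computable

section RecursiveIntSeq

variable {ι κ : Type*} [Primcodable ι] [Primcodable κ] {z w : ι → ℤ} {n : ι → ℕ}

/-- A recursive (multi-)sequence of integers, encoded by sign and absolute value exactly as the
numerators in `RecursiveRatSeq`. -/
@[fun_prop]
def RecursiveIntSeq (z : ι → ℤ) : Prop :=
  ∃ s a : ι → ℕ, Computable s ∧ Computable a ∧ ∀ i, z i = (-1) ^ s i * a i

namespace RecursiveIntSeq

@[fun_prop]
theorem comp (hz : RecursiveIntSeq z) {g : κ → ι} (hg : Computable g) :
    RecursiveIntSeq fun i => z (g i) := by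
  obtain ⟨s, a, hs, ha, h⟩ := hz
  exact ⟨fun i => s (g i), fun i => a (g i), by fun_prop, by fun_prop, fun i => h (g i)⟩

@[fun_prop]
theorem natCast (hn : Computable n) : RecursiveIntSeq fun i => (n i : ℤ) :=
  ⟨fun _ => 0, n, by fun_prop, hn, fun i => by simp⟩

@[fun_prop]
theorem one : RecursiveIntSeq fun _ : ι => (1 : ℤ) := by
  simpa using natCast (Computable.const (α := ι) 1)

@[fun_prop]
theorem neg (hz : RecursiveIntSeq z) : RecursiveIntSeq fun i => -z i := by
  obtain ⟨s, a, hs, ha, h⟩ := hz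
  exact ⟨fun i => s i + 1, a, by fun_prop, ha, fun i => by simp only [h i]; ring⟩

@[fun_prop]
theorem mul (hz : RecursiveIntSeq z) (hw : RecursiveIntSeq w) :
    RecursiveIntSeq fun i => z i * w i := by
  obtain ⟨s, a, hs, ha, h⟩ := hz
  obtain ⟨t, b, ht, hb, h'⟩ := hw
  refine ⟨fun i => s i + t i, fun i => a i * b i, by fun_prop, by fun_prop, fun i => ?_⟩
  simp only [h i, h' i]
  push_cast
  ring

@[fun_prop]
theorem pow (hz : RecursiveIntSeq z) (hn : Computable n) : RecursiveIntSeq fun i => z i ^ n i := by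
  obtain ⟨s, a, hs, ha, h⟩ := hz
  refine ⟨fun i => s i * n i, fun i => a i ^ n i, by fun_prop, by fun_prop, fun i => ?_⟩
  simp only [h i, mul_pow, pow_mul]
  push_cast
  rfl

@[fun_prop]
theorem natAbs (hz : RecursiveIntSeq z) : Computable fun i => (z i).natAbs := by
  obtain ⟨s, a, -, ha, h⟩ := hz
  exact ha.of_eq fun i => by simp [h i, Int.natAbs_mul, Int.natAbs_pow]

theorem of_eq_sub {p q : ι → ℕ} (hp : Computable p) (hq : Computable q)
    (h : ∀ i, z i = p i - q i) : RecursiveIntSeq z := by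
  refine ⟨fun i => 1 - (p i + 1 - q i), fun i => (p i - q i) + (q i - p i), by fun_prop,
    by fun_prop, fun i => ?_⟩
  dsimp only
  rcases lt_or_ge (p i) (q i) with hlt | hge
  · rw [h i, show 1 - (p i + 1 - q i) = 1 by omega, pow_one]
    omega
  · rw [h i, show 1 - (p i + 1 - q i) = 0 by omega, pow_zero]
    omega

theorem exists_eq_sub (hz : RecursiveIntSeq z) :
    ∃ p q : ι → ℕ, Computable p ∧ Computable q ∧ ∀ i, z i = p i - q i := by
  obtain ⟨s, a, hs, ha, h⟩ := hz
  refine ⟨fun i => a i * ((s i + 1) % 2), fun i => a i * (s i % 2), by fun_prop, by fun_prop,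
    fun i => ?_⟩
  dsimp only
  rcases Nat.even_or_odd (s i) with hs | hs
  · rw [h i, hs.neg_one_pow, Nat.even_iff.1 hs, Nat.odd_iff.1 hs.add_one]
    simp
  · rw [h i, hs.neg_one_pow, Nat.odd_iff.1 hs, Nat.even_iff.1 hs.add_one]
    simp

@[fun_prop]
theorem add (hz : RecursiveIntSeq z) (hw : RecursiveIntSeq w) :
    RecursiveIntSeq fun i => z i + w i := by
  obtain ⟨p, q, hp, hq, h⟩ := hz.exists_eq_sub
  obtain ⟨p', q', hp', hq', h'⟩ := hw.exists_eq_sub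
  refine of_eq_sub (p := fun i => p i + p' i) (q := fun i => q i + q' i) (by fun_prop)
    (by fun_prop) fun i => ?_
  rw [h i, h' i]
  push_cast
  ring

@[fun_prop]
theorem sum_range {u : ι → ℕ → ℤ} (hu : RecursiveIntSeq fun p : ι × ℕ => u p.1 p.2)
    (hn : Computable n) : RecursiveIntSeq fun i => ∑ j ∈ Finset.range (n i), u i j := by
  obtain ⟨p, q, hp, hq, h⟩ := hu.exists_eq_sub
  refine of_eq_sub (p := fun i => ∑ j ∈ Finset.range (n i), p (i, j))
    (q := fun i => ∑ j ∈ Finset.range (n i), q (i, j)) (by fun_prop) (by fun_prop) fun i => ?_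
  rw [Finset.sum_congr rfl fun j _ => h (i, j), Finset.sum_sub_distrib]
  push_cast
  rfl

theorem exists_forall_lt {z w : ι × ℕ → ℤ} (hz : RecursiveIntSeq z) (hw : RecursiveIntSeq w)
    (h : ∀ i, ∃ n, z (i, n) < w (i, n)) :
    ∃ c : ι → ℕ, Computable c ∧ ∀ i, z (i, c i) < w (i, c i) := by
  obtain ⟨p, q, hp, hq, hpq⟩ := hz.exists_eq_sub
  obtain ⟨p', q', hp', hq', hpq'⟩ := hw.exists_eq_sub
  have hiff : ∀ j, p j + q' j < p' j + q j ↔ z j < w j := fun j => by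
    rw [hpq j, hpq' j]
    omega
  simp only [← hiff] at h ⊢
  exact exists_computable_forall_lt (f := fun j => p j + q' j) (g := fun j => p' j + q j)
    (by fun_prop) (by fun_prop) h

end RecursiveIntSeq

end RecursiveIntSeq

section ComputableRealSeq

open Filter Topology

variable {ι κ : Type*} [Primcodable ι] [Primcodable κ] {x y : ι → ℝ} {n : ι → ℕ}

theorem natCast_mul_inv_two_pow_le {C k N : ℕ} (h : N + C ≤ k) :
    (C : ℝ) * 2⁻¹ ^ k ≤ 2⁻¹ ^ N := by
  calc (C : ℝ) * 2⁻¹ ^ k ≤ 2 ^ C * 2⁻¹ ^ (N + C) := by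
        gcongr ?_ * ?_
        · exact_mod_cast Nat.lt_two_pow_self.le
        · exact pow_le_pow_of_le_one (by norm_num) (by norm_num) h
    _ = 2⁻¹ ^ N := by
        rw [pow_add, mul_left_comm, ← mul_pow]
        norm_num

theorem tendsto_const_mul_inv_two_pow (C : ℝ) :
    Tendsto (fun n : ℕ => C * 2⁻¹ ^ n) atTop (𝓝 0) := by
  simpa using (tendsto_pow_atTop_nhds_zero_of_lt_one (r := (2 : ℝ)⁻¹) (by norm_num)
    (by norm_num)).const_mul C

theorem abs_natCast_round_div_sub_le (a : ℕ) {b : ℕ} (hb : b ≠ 0) :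
    |(((2 * a + b) / (2 * b) : ℕ) : ℝ) - a / b| ≤ 2⁻¹ := by
  have hle := Nat.floor_le (show (0 : ℝ) ≤ ((2 * a + b : ℕ) : ℝ) / (2 * b : ℕ) by positivity)
  have hlt := Nat.lt_floor_add_one (((2 * a + b : ℕ) : ℝ) / (2 * b : ℕ))
  rw [Nat.floor_div_eq_div] at hle hlt
  have hsplit : ((2 * a + b : ℕ) : ℝ) / (2 * b : ℕ) = a / b + 2⁻¹ := by
    push_cast
    field_simp
  rw [abs_le]
  constructor <;> linarith

theorem abs_le_add_one_of_abs_sub_le {X t ε B : ℝ} (hX : |X - t| ≤ ε) (hε : ε ≤ 1) (ht : |t| ≤ B) :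
    |X| ≤ B + 1 := by
  linarith [abs_sub_abs_le_abs_sub X t]

theorem ne_zero_and_abs_inv_sub_inv_le {X t c ε : ℝ} (hc : 1 < c * |t|) (hX : |X - t| ≤ ε)
    (hε : 2 * c * ε ≤ 1) : X ≠ 0 ∧ |X⁻¹ - t⁻¹| ≤ 2 * c ^ 2 * ε := by
  have hc0 : 0 < c := pos_of_mul_pos_left (one_pos.trans hc) (abs_nonneg t)
  have ht0 : 0 < |t| := pos_of_mul_pos_right (one_pos.trans hc) hc0.le
  have hXc : 1 < 2 * c * |X| := by
    have htX : |t| - ε ≤ |X| := by linarith [abs_sub_abs_le_abs_sub t X, abs_sub_comm t X]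
    nlinarith
  have hε0 : 0 ≤ ε := (abs_nonneg _).trans hX
  have hX0 : 0 < |X| := pos_of_mul_pos_right (one_pos.trans hXc) (by positivity)
  refine ⟨abs_pos.1 hX0, ?_⟩
  calc |X⁻¹ - t⁻¹| = |X|⁻¹ * |X - t| * |t|⁻¹ := by
        rw [inv_sub_inv (abs_pos.1 hX0) (abs_pos.1 ht0), abs_div, abs_mul, abs_sub_comm]
        field_simp
    _ ≤ 2 * c * ε * c := by
        gcongr
        · exact (inv_lt_iff_one_lt_mul₀ hX0).2 hXc |>.le
        · exact (inv_lt_iff_one_lt_mul₀ ht0).2 hc |>.le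
    _ = 2 * c ^ 2 * ε := by ring

attribute [fun_prop] ComputableRealSeq

namespace ComputableRealSeq

protected theorem of_approx {z : ι × ℕ → ℤ} {d : ι × ℕ → ℕ} {C : ι → ℕ} (hz : RecursiveIntSeq z)
    (hd : Computable d) (hC : Computable C) (hd0 : ∀ i, d i ≠ 0)
    (h : ∀ i k, |(z (i, k) : ℝ) / d (i, k) - x i| ≤ C i * 2⁻¹ ^ k) : ComputableRealSeq x := by
  obtain ⟨s, a, hs, ha, hz⟩ := hz
  refine ⟨fun j => (z j : ℚ) / d j, ⟨s, a, d, hs, ha, hd, fun j => ⟨hd0 j, ?_⟩⟩,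
    fun j => j.2 + C j.1, by fun_prop, fun i N k hk => ?_⟩
  · simp only [hz j]
    push_cast
    rfl
  · push_cast
    exact (h i k).trans (natCast_mul_inv_two_pow_le hk)

theorem exists_dyadic (hx : ComputableRealSeq x) :
    ∃ z : ι × ℕ → ℤ, RecursiveIntSeq z ∧ ∀ i k, |(z (i, k) : ℝ) / 2 ^ k - x i| ≤ 2⁻¹ ^ k := by
  obtain ⟨r, ⟨s, a, b, hs, ha, hb, hr⟩, e, he, h⟩ := hx
  let j : ι × ℕ → ι × ℕ := fun i => (i.1, e (i.1, i.2 + 1))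
  let m : ι × ℕ → ℕ := fun i => (2 * (2 ^ i.2 * a (j i)) + b (j i)) / (2 * b (j i))
  have hj : Computable j := by fun_prop
  refine ⟨fun i => (-1) ^ s (j i) * m i, ⟨fun i => s (j i), m, by fun_prop, by fun_prop,
    fun _ => rfl⟩, fun i k => ?_⟩
  obtain ⟨hb0, hrj⟩ := hr (j (i, k))
  have hround := abs_natCast_round_div_sub_le (2 ^ k * a (j (i, k))) hb0
  have hdyadic : |((((-1) ^ s (j (i, k)) * m (i, k) : ℤ) : ℝ)) / 2 ^ k - r (j (i, k))| ≤
      2⁻¹ ^ (k + 1) := by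
    have hfactor : (((-1) ^ s (j (i, k)) * m (i, k) : ℤ) : ℝ) / 2 ^ k - r (j (i, k)) =
        (-1) ^ s (j (i, k)) *
          ((m (i, k) - ((2 ^ k * a (j (i, k)) : ℕ) : ℝ) / b (j (i, k))) / 2 ^ k) := by
      rw [hrj]
      push_cast
      field_simp
    rw [hfactor, abs_mul, abs_neg_one_pow, one_mul, abs_div, abs_of_pos (show (0 : ℝ) < 2 ^ k by
      positivity), div_le_iff₀ (by positivity)]
    refine hround.trans_eq ?_
    rw [pow_succ, mul_right_comm, ← mul_pow]
    norm_num
  calc _ ≤ (2 : ℝ)⁻¹ ^ (k + 1) + 2⁻¹ ^ (k + 1) :=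
        (abs_sub_le _ _ _).trans (add_le_add hdyadic (h i (k + 1) _ le_rfl))
    _ = 2⁻¹ ^ k := by ring

@[fun_prop]
protected theorem comp (hx : ComputableRealSeq x) {g : κ → ι} (hg : Computable g) :
    ComputableRealSeq fun i => x (g i) := by
  obtain ⟨z, hz, h⟩ := hx.exists_dyadic
  exact .of_approx (z := fun i => z (g i.1, i.2)) (d := fun i => 2 ^ i.2) (C := fun _ => 1)
    (by fun_prop) (by fun_prop) (by fun_prop) (by simp) fun i k => by simpa using h (g i) k

theorem congr (hx : ComputableRealSeq x) (h : ∀ i, x i = y i) : ComputableRealSeq y := by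
  rwa [← funext h]

@[fun_prop]
protected theorem natCast (hn : Computable n) : ComputableRealSeq fun i => (n i : ℝ) :=
  .of_approx (z := fun i => n i.1) (d := fun _ => 1) (C := fun _ => 0)
    (by fun_prop) (by fun_prop) (by fun_prop) (by simp) fun i k => by simp

@[fun_prop]
protected theorem zero : ComputableRealSeq fun _ : ι => (0 : ℝ) := by
  simpa using ComputableRealSeq.natCast (Computable.const (α := ι) 0)

@[fun_prop]
protected theorem one : ComputableRealSeq fun _ : ι => (1 : ℝ) := by
  simpa using ComputableRealSeq.natCast (Computable.const (α := ι) 1)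

@[fun_prop]
protected theorem ofNat (c : ℕ) [c.AtLeastTwo] :
    ComputableRealSeq fun _ : ι => (OfNat.ofNat c : ℝ) :=
  .natCast (Computable.const (OfNat.ofNat c))

@[fun_prop]
protected theorem neg (hx : ComputableRealSeq x) : ComputableRealSeq fun i => -x i := by
  obtain ⟨z, hz, h⟩ := hx.exists_dyadic
  refine .of_approx (z := fun i => -z i) (d := fun i => 2 ^ i.2) (C := fun _ => 1)
    (by fun_prop) (by fun_prop) (by fun_prop) (by simp) fun i k => ?_
  rw [← abs_neg]
  convert h i k using 2
  · push_cast
    ring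
  · simp

@[fun_prop]
protected theorem add (hx : ComputableRealSeq x) (hy : ComputableRealSeq y) :
    ComputableRealSeq fun i => x i + y i := by
  obtain ⟨z, hz, h⟩ := hx.exists_dyadic
  obtain ⟨w, hw, h'⟩ := hy.exists_dyadic
  refine .of_approx (z := fun i => z i + w i) (d := fun i => 2 ^ i.2) (C := fun _ => 2)
    (by fun_prop) (by fun_prop) (by fun_prop) (by simp) fun i k => ?_
  push_cast
  rw [add_div, add_sub_add_comm, two_mul]
  exact (abs_add_le _ _).trans (add_le_add (h i k) (h' i k))

@[fun_prop]
protected theorem sub (hx : ComputableRealSeq x) (hy : ComputableRealSeq y) :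
    ComputableRealSeq fun i => x i - y i :=
  (hx.add hy.neg).congr fun _ => (sub_eq_add_neg _ _).symm

@[fun_prop]
protected theorem abs (hx : ComputableRealSeq x) : ComputableRealSeq fun i => |x i| := by
  obtain ⟨z, hz, h⟩ := hx.exists_dyadic
  refine .of_approx (z := fun i => (z i).natAbs) (d := fun i => 2 ^ i.2) (C := fun _ => 1)
    (by fun_prop) (by fun_prop) (by fun_prop) (by simp) fun i k => ?_
  calc _ = |(|(z (i, k) : ℝ) / 2 ^ k| - |x i|)| := by
        rw [Int.cast_natCast, Nat.cast_natAbs, abs_div]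
        simp
    _ ≤ |(z (i, k) : ℝ) / 2 ^ k - x i| := abs_abs_sub_abs_le_abs_sub _ _
    _ ≤ _ := by simpa using h i k

theorem exists_bound (hx : ComputableRealSeq x) :
    ∃ B : ι → ℕ, Computable B ∧ ∀ i, |x i| ≤ B i := by
  obtain ⟨z, hz, h⟩ := hx.exists_dyadic
  refine ⟨fun i => (z (i, 0)).natAbs + 1, by fun_prop, fun i => ?_⟩
  have happrox : |x i - z (i, 0)| ≤ 1 := by simpa [abs_sub_comm] using h i 0
  push_cast [Nat.cast_natAbs]
  linarith [abs_sub_abs_le_abs_sub (x i) (z (i, 0))]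

@[fun_prop]
protected theorem mul (hx : ComputableRealSeq x) (hy : ComputableRealSeq y) :
    ComputableRealSeq fun i => x i * y i := by
  obtain ⟨B, hB, hxB⟩ := hx.exists_bound
  obtain ⟨C, hC, hyC⟩ := hy.exists_bound
  obtain ⟨z, hz, h⟩ := hx.exists_dyadic
  obtain ⟨w, hw, h'⟩ := hy.exists_dyadic
  refine .of_approx (z := fun i => z i * w i) (d := fun i => 2 ^ i.2 * 2 ^ i.2)
    (C := fun i => B i + 1 + C i) (by fun_prop) (by fun_prop) (by fun_prop) (by simp)
    fun i k => ?_
  have hε : (2 : ℝ)⁻¹ ^ k ≤ 1 := pow_le_one₀ (by norm_num) (by norm_num)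
  push_cast
  rw [mul_div_mul_comm]
  set X := (z (i, k) : ℝ) / 2 ^ k
  set Y := (w (i, k) : ℝ) / 2 ^ k
  have hXB : |X| ≤ B i + 1 := abs_le_add_one_of_abs_sub_le (h i k) hε (hxB i)
  calc |X * Y - x i * y i| = |X * (Y - y i) + (X - x i) * y i| := by ring_nf
    _ ≤ |X| * |Y - y i| + |X - x i| * |y i| := by
        rw [← abs_mul, ← abs_mul]
        exact abs_add_le _ _
    _ ≤ (B i + 1) * 2⁻¹ ^ k + 2⁻¹ ^ k * C i := by
        gcongr
        exacts [h' i k, h i k, hyC i]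
    _ = (B i + 1 + C i) * 2⁻¹ ^ k := by ring

@[fun_prop]
protected theorem pow (hx : ComputableRealSeq x) (hn : Computable n) :
    ComputableRealSeq fun i => x i ^ n i := by
  obtain ⟨B, hB, hxB⟩ := hx.exists_bound
  obtain ⟨z, hz, h⟩ := hx.exists_dyadic
  refine .of_approx (z := fun i => z i ^ n i.1) (d := fun i => (2 ^ i.2) ^ n i.1)
    (C := fun i => n i * (B i + 1) ^ (n i - 1)) (by fun_prop) (by fun_prop) (by fun_prop)
    (by simp) fun i k => ?_
  have hε : (2 : ℝ)⁻¹ ^ k ≤ 1 := pow_le_one₀ (by norm_num) (by norm_num)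
  push_cast
  rw [← div_pow]
  have hXB := abs_le_add_one_of_abs_sub_le (h i k) hε (hxB i)
  calc _ ≤ |(z (i, k) : ℝ) / 2 ^ k - x i| * n i *
          (max |(z (i, k) : ℝ) / 2 ^ k| |x i|) ^ (n i - 1) := abs_pow_sub_pow_le _ _ _
    _ ≤ 2⁻¹ ^ k * n i * (B i + 1) ^ (n i - 1) := by
        gcongr
        · exact h i k
        · exact max_le hXB (by linarith [hxB i])
    _ = n i * (B i + 1) ^ (n i - 1) * 2⁻¹ ^ k := by ring

@[fun_prop]
protected theorem sum_range {u : ι → ℕ → ℝ} (hu : ComputableRealSeq fun p : ι × ℕ => u p.1 p.2)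
    (hn : Computable n) : ComputableRealSeq fun i => ∑ j ∈ Finset.range (n i), u i j := by
  obtain ⟨z, hz, h⟩ := hu.exists_dyadic
  refine .of_approx (z := fun i => ∑ j ∈ Finset.range (n i.1), z ((i.1, j), i.2))
    (d := fun i => 2 ^ i.2) (C := n) (by fun_prop) (by fun_prop) hn (by simp) fun i k => ?_
  push_cast
  rw [Finset.sum_div, ← Finset.sum_sub_distrib]
  calc _ ≤ ∑ _j ∈ Finset.range (n i), (2 : ℝ)⁻¹ ^ k :=
        (Finset.abs_sum_le_sum_abs _ _).trans (Finset.sum_le_sum fun j _ => h (i, j) k)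
    _ = n i * 2⁻¹ ^ k := by simp

theorem exists_forall_lt {x y : ι × ℕ → ℝ} (hx : ComputableRealSeq x) (hy : ComputableRealSeq y)
    (h : ∀ i, ∃ n, x (i, n) < y (i, n)) :
    ∃ c : ι → ℕ, Computable c ∧ ∀ i, x (i, c i) < y (i, c i) := by
  obtain ⟨z, hz, hzx⟩ := (hy.sub hx).exists_dyadic
  -- Search simultaneously for `n` and for a precision at which `x (i, n) < y (i, n)` is visible.
  let u : ι × ℕ → (ι × ℕ) × ℕ := fun i => ((i.1, i.2.unpair.1), i.2.unpair.2)
  obtain ⟨c, hc, hlt⟩ := RecursiveIntSeq.exists_forall_lt (z := fun _ => 1) (w := fun i => z (u i))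
    (by fun_prop) (by fun_prop) fun i => by
      obtain ⟨n, hn⟩ := h i
      obtain ⟨k, hk⟩ := exists_pow_lt_of_lt_one (show 0 < (y (i, n) - x (i, n)) / 2 by linarith)
        (show (2 : ℝ)⁻¹ < 1 by norm_num)
      refine ⟨Nat.pair n k, ?_⟩
      have hz1 : (2 : ℝ)⁻¹ ^ k < z ((i, n), k) / 2 ^ k := by
        linarith [(abs_le.1 (hzx (i, n) k)).1]
      rw [inv_pow, inv_eq_one_div, div_lt_div_iff_of_pos_right (by positivity)] at hz1
      simpa [u] using (by exact_mod_cast hz1 : 1 < z ((i, n), k))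
  refine ⟨fun i => (c i).unpair.1, by fun_prop, fun i => ?_⟩
  have hz1 : (2 : ℝ)⁻¹ ^ (c i).unpair.2 < z (u (i, c i)) / 2 ^ (c i).unpair.2 := by
    rw [inv_pow, inv_eq_one_div, div_lt_div_iff_of_pos_right (by positivity)]
    exact_mod_cast hlt i
  linarith [(abs_le.1 (hzx (i, (c i).unpair.1) (c i).unpair.2)).2]

theorem exists_one_lt_mul_abs (hx : ComputableRealSeq x) (h0 : ∀ i, x i ≠ 0) :
    ∃ c : ι → ℕ, Computable c ∧ ∀ i, 1 < c i * |x i| := by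
  refine exists_forall_lt (x := fun _ => 1) (y := fun i : ι × ℕ => i.2 * |x i.1|) (by fun_prop)
    (by fun_prop) fun i => ?_
  obtain ⟨n, hn⟩ := exists_nat_gt |x i|⁻¹
  exact ⟨n, (inv_lt_iff_one_lt_mul₀ (abs_pos.2 (h0 i))).1 hn⟩

@[fun_prop]
protected theorem inv (hx : ComputableRealSeq x) (h0 : ∀ i, x i ≠ 0) :
    ComputableRealSeq fun i => (x i)⁻¹ := by
  obtain ⟨c, hc, hcx⟩ := hx.exists_one_lt_mul_abs h0
  obtain ⟨z, hz, h⟩ := hx.exists_dyadic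
  let K : ι × ℕ → ℕ := fun i => i.2 + 2 * c i.1
  have hdyadic : ∀ i, (z (i.1, K i) : ℝ) / 2 ^ K i ≠ 0 ∧
      |((z (i.1, K i) : ℝ) / 2 ^ K i)⁻¹ - (x i.1)⁻¹| ≤ 2 * c i.1 ^ 2 * 2⁻¹ ^ K i := fun i => by
    refine ne_zero_and_abs_inv_sub_inv_le (hcx i.1) (h i.1 (K i)) ?_
    have hprec := natCast_mul_inv_two_pow_le (C := 2 * c i.1) (k := K i) (N := 0)
      (Nat.add_le_add_right (Nat.zero_le _) _)
    simpa only [Nat.cast_mul, Nat.cast_ofNat, pow_zero] using hprec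
  have hz0 : ∀ i, z (i.1, K i) ≠ 0 := fun i hzi => (hdyadic i).1 (by simp [hzi])
  refine .of_approx (z := fun i => (2 ^ K i : ℕ) * z (i.1, K i))
    (d := fun i => (z (i.1, K i)).natAbs ^ 2) (C := fun i => 2 * c i ^ 2) (by fun_prop)
    (by fun_prop) (by fun_prop) (fun i => pow_ne_zero 2 (Int.natAbs_ne_zero.2 (hz0 i)))
    fun i k => ?_
  have hz0' : (z (i, K (i, k)) : ℝ) ≠ 0 := Int.cast_ne_zero.2 (hz0 (i, k))
  calc _ = |((z (i, K (i, k)) : ℝ) / 2 ^ K (i, k))⁻¹ - (x i)⁻¹| := by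
        push_cast [Nat.cast_natAbs]
        rw [sq_abs]
        field_simp
    _ ≤ 2 * c i ^ 2 * 2⁻¹ ^ K (i, k) := (hdyadic (i, k)).2
    _ ≤ _ := by
        push_cast
        gcongr ?_ * ?_
        exact pow_le_pow_of_le_one (by norm_num) (by norm_num) (Nat.le_add_right _ _)

@[fun_prop]
protected theorem div (hx : ComputableRealSeq x) (hy : ComputableRealSeq y) (h0 : ∀ i, y i ≠ 0) :
    ComputableRealSeq fun i => x i / y i :=
  (hx.mul (hy.inv h0)).congr fun _ => (div_eq_mul_inv _ _).symm

@[fun_prop]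
protected theorem max (hx : ComputableRealSeq x) (hy : ComputableRealSeq y) :
    ComputableRealSeq fun i => max (x i) (y i) := by
  have h : ComputableRealSeq fun i => (2 : ℝ)⁻¹ * (x i + y i + |y i - x i|) := by
    fun_prop (disch := norm_num)
  exact h.congr fun i => (sup_eq_half_smul_add_add_abs_sub' ℝ (x i) (y i)).symm

@[fun_prop]
protected theorem min (hx : ComputableRealSeq x) (hy : ComputableRealSeq y) :
    ComputableRealSeq fun i => min (x i) (y i) :=
  (hx.neg.max hy.neg).neg.congr fun i => by rw [max_neg_neg, neg_neg]

theorem exists_lt_inv_two_pow {b : ι × ℕ → ℝ} (hb : ComputableRealSeq b)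
    (hb0 : ∀ i, Tendsto (fun n => b (i, n)) atTop (𝓝 0)) :
    ∃ c : ι × ℕ → ℕ, Computable c ∧ ∀ i k, b (i, c (i, k)) < 2⁻¹ ^ k := by
  obtain ⟨c, hc, h⟩ := exists_forall_lt (x := fun j : (ι × ℕ) × ℕ => b (j.1.1, j.2))
    (y := fun j => 2⁻¹ ^ j.1.2) (by fun_prop) (by fun_prop (disch := norm_num)) fun j =>
      ((hb0 j.1).eventually_lt_const (show (0 : ℝ) < 2⁻¹ ^ j.2 by positivity)).exists
  exact ⟨c, hc, fun i k => h (i, k)⟩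

theorem of_limit {u b : ι × ℕ → ℝ} (hu : ComputableRealSeq u) (hb : ComputableRealSeq b)
    (h : ∀ i n, |u (i, n) - x i| ≤ b (i, n))
    (hb0 : ∀ i, Tendsto (fun n => b (i, n)) atTop (𝓝 0)) : ComputableRealSeq x := by
  obtain ⟨c, hc, hbc⟩ := hb.exists_lt_inv_two_pow hb0
  obtain ⟨z, hz, hzu⟩ := hu.exists_dyadic
  refine .of_approx (z := fun i => z ((i.1, c i), i.2)) (d := fun i => 2 ^ i.2) (C := fun _ => 2)
    (by fun_prop) (by fun_prop) (by fun_prop) (by simp) fun i k => ?_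
  push_cast
  rw [two_mul]
  exact (abs_sub_le _ _ _).trans (add_le_add (hzu _ _) ((h _ _).trans (hbc i k).le))

theorem of_hasSum {u : ι → ℕ → ℝ} {C : ι → ℕ} (hu : ComputableRealSeq fun p : ι × ℕ => u p.1 p.2)
    (hC : Computable C) (hle : ∀ i n, |u i n| ≤ C i * 2⁻¹ ^ n) (h : ∀ i, HasSum (u i) (x i)) :
    ComputableRealSeq x := by
  refine of_limit (u := fun p => ∑ j ∈ Finset.range p.2, u p.1 j)
    (b := fun p => C p.1 * 2⁻¹ ^ p.2 / (1 - 2⁻¹)) (by fun_prop)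
    (by fun_prop (disch := norm_num)) (fun i n =>
      norm_sub_le_of_geometric_bound_of_hasSum (by norm_num) (hle i) (h i) n) fun i => ?_
  simpa using (tendsto_const_mul_inv_two_pow (C i)).div_const (1 - 2⁻¹)

end ComputableRealSeq

end ComputableRealSeq

section ElementaryFunctions

theorem pow_div_factorial_le {t : ℝ} {B : ℕ} (h : |t| ≤ B) (m : ℕ) :
    |t| ^ m / m.factorial ≤ 9 ^ B * 2⁻¹ ^ m := by
  have hexp : Real.exp (2 * B) ≤ 9 ^ B := by
    rw [mul_comm, Real.exp_nat_mul]
    gcongr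
    calc Real.exp 2 = Real.exp 1 ^ 2 := by rw [← Real.exp_nat_mul]; norm_num
      _ ≤ 3 ^ 2 := by gcongr; exact Real.exp_one_lt_three.le
      _ = 9 := by norm_num
  calc |t| ^ m / m.factorial ≤ B ^ m / m.factorial := by gcongr
    _ = (2 * B) ^ m / m.factorial * 2⁻¹ ^ m := by
        rw [div_mul_eq_mul_div, ← mul_pow]
        ring_nf
    _ ≤ 9 ^ B * 2⁻¹ ^ m := by
        gcongr
        exact (Real.pow_div_factorial_le_exp _ (by positivity) m).trans hexp

theorem abs_neg_one_pow_mul_pow_div_factorial_le {t : ℝ} {B n m : ℕ} (h : |t| ≤ B) (hnm : n ≤ m) :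
    |(-1) ^ n * t ^ m / m.factorial| ≤ (9 ^ B : ℕ) * 2⁻¹ ^ n := by
  rw [abs_div, abs_mul, abs_neg_one_pow, one_mul, abs_pow, Nat.abs_cast, Nat.cast_pow,
    Nat.cast_ofNat]
  refine (pow_div_factorial_le h m).trans ?_
  gcongr ?_ * ?_
  exact pow_le_pow_of_le_one (by norm_num) (by norm_num) hnm

namespace ComputableRealSeq

variable {ι : Type*} [Primcodable ι] {x : ι → ℝ}

@[fun_prop]
protected theorem cos (hx : ComputableRealSeq x) : ComputableRealSeq fun i => Real.cos (x i) := by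
  obtain ⟨B, hB, hxB⟩ := hx.exists_bound
  exact of_hasSum (u := fun i n => (-1) ^ n * x i ^ (2 * n) / (2 * n).factorial)
    (C := fun i => 9 ^ B i) (by fun_prop (disch := intro; positivity)) (by fun_prop)
    (fun i n => abs_neg_one_pow_mul_pow_div_factorial_le (hxB i) (by omega))
    fun i => Real.hasSum_cos (x i)

@[fun_prop]
protected theorem sin (hx : ComputableRealSeq x) : ComputableRealSeq fun i => Real.sin (x i) := by
  obtain ⟨B, hB, hxB⟩ := hx.exists_bound
  exact of_hasSum (u := fun i n => (-1) ^ n * x i ^ (2 * n + 1) / (2 * n + 1).factorial)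
    (C := fun i => 9 ^ B i) (by fun_prop (disch := intro; positivity)) (by fun_prop)
    (fun i n => abs_neg_one_pow_mul_pow_div_factorial_le (hxB i) (by omega))
    fun i => Real.hasSum_sin (x i)

theorem arctan_of_abs_le (hx : ComputableRealSeq x) (hle : ∀ i, |x i| ≤ 2⁻¹) :
    ComputableRealSeq fun i => Real.arctan (x i) := by
  refine of_hasSum (u := fun i n => (-1) ^ n * x i ^ (2 * n + 1) / ((2 * n + 1 : ℕ) : ℝ))
    (C := fun _ => 1) (by fun_prop (disch := intro; positivity)) (by fun_prop) (fun i n => ?_)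
    fun i => Real.hasSum_arctan ((hle i).trans_lt (by norm_num))
  rw [abs_div, abs_mul, abs_neg_one_pow, one_mul, abs_pow, Nat.abs_cast, Nat.cast_one, one_mul]
  calc _ ≤ |x i| ^ (2 * n + 1) := div_le_self (by positivity) (by norm_cast; omega)
    _ ≤ 2⁻¹ ^ (2 * n + 1) := by gcongr; exact hle i
    _ ≤ 2⁻¹ ^ n := pow_le_pow_of_le_one (by norm_num) (by norm_num) (by omega)

@[fun_prop]
protected theorem pi : ComputableRealSeq fun _ : ι => Real.pi := by
  have h2 : ComputableRealSeq fun _ : ι => Real.arctan 2⁻¹ :=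
    arctan_of_abs_le (by fun_prop (disch := norm_num)) fun _ => by norm_num [abs_of_pos]
  have h3 : ComputableRealSeq fun _ : ι => Real.arctan 3⁻¹ :=
    arctan_of_abs_le (by fun_prop (disch := norm_num)) fun _ => by norm_num [abs_of_pos]
  have hpi : ComputableRealSeq fun _ : ι => 4 * (Real.arctan 2⁻¹ + Real.arctan 3⁻¹) := by fun_prop
  exact hpi.congr fun _ => by rw [Real.arctan_inv_2_add_arctan_inv_3]; ring

end ComputableRealSeq

end ElementaryFunctions

section ComputableComplexSeq

variable {ι : Type*} [Primcodable ι] {z : ι → ℂ}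

theorem computableComplexSeq_iff : ComputableComplexSeq z ↔
    (ComputableRealSeq fun i => (z i).re) ∧ ComputableRealSeq fun i => (z i).im := by
  constructor
  · rintro ⟨r, s, hr, hs, e, he, h⟩
    exact ⟨⟨r, hr, e, he, fun i N k hk => by
        simpa using (Complex.abs_re_le_norm _).trans (h i N k hk)⟩,
      ⟨s, hs, e, he, fun i N k hk => by
        simpa using (Complex.abs_im_le_norm _).trans (h i N k hk)⟩⟩
  · rintro ⟨⟨r, hr, e, he, h⟩, s, hs, e', he', h'⟩
    refine ⟨r, s, hr, hs, fun i => e (i.1, i.2 + 1) + e' (i.1, i.2 + 1), by fun_prop,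
      fun i N k hk => ?_⟩
    dsimp only at hk
    calc _ ≤ |(r (i, k) : ℝ) - (z i).re| + |(s (i, k) : ℝ) - (z i).im| := by
          simpa using Complex.norm_le_abs_re_add_abs_im
            ((r (i, k) : ℂ) + (s (i, k) : ℂ) * Complex.I - z i)
      _ ≤ (2 : ℝ)⁻¹ ^ (N + 1) + 2⁻¹ ^ (N + 1) :=
          add_le_add (h i (N + 1) k (by omega)) (h' i (N + 1) k (by omega))
      _ = 2⁻¹ ^ N := by ring

end ComputableComplexSeq

section ComputableRealFunSeq

variable {ι κ : Type*} [Primcodable ι] [Primcodable κ]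

@[fun_prop]
theorem RecursiveIntSeq.optionElim {z : ι → κ → ℤ} (hz : RecursiveIntSeq fun p : ι × κ => z p.1 p.2)
    {o : ι → Option κ} (ho : Computable o) : RecursiveIntSeq fun i => (o i).elim 0 (z i) := by
  obtain ⟨s, a, hs, ha, h⟩ := hz
  have helim {b : ι × κ → ℕ} (hb : Computable b) :
      Computable fun i => (o i).elim 0 fun k => b (i, k) :=
    (Computable.option_casesOn ho (Computable.const 0) hb.to₂).of_eq fun i => by
      cases o i <;> rfl
  refine ⟨_, _, helim hs, helim ha, fun i => ?_⟩
  dsimp only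
  cases o i with
  | none => simp
  | some k => exact h (i, k)

theorem ComputableRealSeq.exists_apply_encode_eq {x : ι → ℝ} (hx : ComputableRealSeq x) :
    ∃ X : ℕ → ℝ, ComputableRealSeq X ∧ ∀ i, X (Encodable.encode i) = x i := by
  obtain ⟨z, hz, h⟩ := hx.exists_dyadic
  have hdecode : Computable fun p : ℕ × ℕ => (Encodable.decode p.1 : Option ι) :=
    Computable.decode.comp Computable.fst
  refine ⟨fun n => (Encodable.decode n).elim 0 x, .of_approx
    (z := fun p => (Encodable.decode p.1 : Option ι).elim 0 fun i => z (i, p.2))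
    (d := fun p => 2 ^ p.2) (C := fun _ => 1) (by fun_prop) (by fun_prop) (by fun_prop)
    (by simp) fun n k => ?_, by simp⟩
  cases (Encodable.decode n : Option ι) with
  | none => simp
  | some i => simpa using h i k

theorem ComputableRealFunSeq.apply {f : ℕ → ℝ → ℝ} (hf : ComputableRealFunSeq f) {n : ι → ℕ}
    (hn : Computable n) {x : ι → ℝ} (hx : ComputableRealSeq x) :
    ComputableRealSeq fun i => f (n i) (x i) := by
  obtain ⟨X, hX, hXx⟩ := hx.exists_apply_encode_eq
  exact ((hf.sequentially_computable X hX).comp (hn.pair Computable.encode)).congr fun i => by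
    rw [hXx]

theorem EffectivelyContinuous.comp {E : Type*} [NormedAddCommGroup E] {f : ℕ → ℝ → E}
    (hf : EffectivelyContinuous f) {g : ℕ → ℕ} (hg : Computable g) :
    EffectivelyContinuous fun n => f (g n) := by
  obtain ⟨α, hα, h⟩ := hf
  exact ⟨fun p => α (g p.1, p.2), by fun_prop, fun n => h (g n)⟩

theorem ComputableRealFunSeq.comp {f : ℕ → ℝ → ℝ} (hf : ComputableRealFunSeq f) {g : ℕ → ℕ}
    (hg : Computable g) : ComputableRealFunSeq fun n => f (g n) :=
  ⟨fun x hx => hf.apply (n := fun p : ℕ × ℕ => g p.1) (by fun_prop)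
    (x := fun p => x p.2) (by fun_prop), hf.effectively_continuous.comp hg⟩

theorem EffectivelyContinuous.of_lipschitz {E : Type*} [NormedAddCommGroup E] {f : ℕ → ℝ → E}
    {B : ℕ → ℕ} (hB : Computable B) (h : ∀ n x y, ‖f n x - f n y‖ ≤ B n * |x - y|) :
    EffectivelyContinuous f := by
  refine ⟨fun p => p.2.2 + B p.1 + 1, by fun_prop, fun n L k x y hxy _ _ => ?_⟩
  calc ‖f n x - f n y‖ ≤ B n * |x - y| := h n x y
    _ ≤ B n * 2⁻¹ ^ (k + B n + 1) := by gcongr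
    _ ≤ 2⁻¹ ^ (k + 1) := natCast_mul_inv_two_pow_le (by omega)
    _ < 2⁻¹ ^ k := pow_lt_pow_right_of_lt_one₀ (by norm_num) (by norm_num) k.lt_succ_self

theorem EffectivelyContinuous.continuous {E : Type*} [NormedAddCommGroup E] {f : ℕ → ℝ → E}
    (hf : EffectivelyContinuous f) (n : ℕ) : Continuous (f n) := by
  obtain ⟨α, -, h⟩ := hf
  refine continuous_iff_continuousAt.2 fun x => Metric.continuousAt_iff.2 fun ε hε => ?_
  obtain ⟨L, hL⟩ := exists_nat_ge (|x| + 1)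
  obtain ⟨k, hk⟩ := exists_pow_lt_of_lt_one hε (show (2 : ℝ)⁻¹ < 1 by norm_num)
  refine ⟨2⁻¹ ^ α (n, L, k), by positivity, fun {y} hy => ?_⟩
  rw [Real.dist_eq] at hy
  rw [dist_eq_norm]
  have hα1 : (2 : ℝ)⁻¹ ^ α (n, L, k) ≤ 1 := pow_le_one₀ (by norm_num) (by norm_num)
  have hyL : |y| ≤ L := by linarith [abs_sub_abs_le_abs_sub y x]
  exact (h n L k y x hy hyL (by linarith)).trans hk

theorem EffectivelyContinuous.mul {R : Type*} [NormedRing R] {f g : ℕ → ℝ → R}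
    (hf : EffectivelyContinuous f) (hg : EffectivelyContinuous g) {B C : ℕ → ℕ} (hB : Computable B)
    (hC : Computable C) (hfB : ∀ n x, ‖f n x‖ ≤ B n) (hgC : ∀ n x, ‖g n x‖ ≤ C n) :
    EffectivelyContinuous fun n x => f n x * g n x := by
  obtain ⟨α, hα, hfα⟩ := hf
  obtain ⟨β, hβ, hgβ⟩ := hg
  refine ⟨fun p => α (p.1, p.2.1, p.2.2 + 2 + C p.1) + β (p.1, p.2.1, p.2.2 + 2 + B p.1),
    by fun_prop, fun n L k x y hxy hx hy => ?_⟩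
  have hmono {a b : ℕ} (hab : a ≤ b) : (2 : ℝ)⁻¹ ^ b ≤ 2⁻¹ ^ a :=
    pow_le_pow_of_le_one (by norm_num) (by norm_num) hab
  have hf' := (hfα n L (k + 2 + C n) x y (hxy.trans_le (hmono (Nat.le_add_right _ _))) hx hy).le
  have hg' := (hgβ n L (k + 2 + B n) x y (hxy.trans_le (hmono (Nat.le_add_left _ _))) hx hy).le
  calc ‖f n x * g n x - f n y * g n y‖
      = ‖f n x * (g n x - g n y) + (f n x - f n y) * g n y‖ := by noncomm_ring
    _ ≤ ‖f n x‖ * ‖g n x - g n y‖ + ‖f n x - f n y‖ * ‖g n y‖ :=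
        (norm_add_le _ _).trans (add_le_add (norm_mul_le _ _) (norm_mul_le _ _))
    _ ≤ B n * 2⁻¹ ^ (k + 2 + B n) + 2⁻¹ ^ (k + 2 + C n) * C n := by
        gcongr
        exacts [hfB n x, hgC n y]
    _ ≤ 2⁻¹ ^ (k + 2) + 2⁻¹ ^ (k + 2) := by
        rw [mul_comm _ (C n : ℝ)]
        exact add_le_add (natCast_mul_inv_two_pow_le le_rfl) (natCast_mul_inv_two_pow_le le_rfl)
    _ = 2⁻¹ ^ (k + 1) := by ring
    _ < 2⁻¹ ^ k := pow_lt_pow_right_of_lt_one₀ (by norm_num) (by norm_num) k.lt_succ_self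

theorem ComputableRealFunSeq.mul {f g : ℕ → ℝ → ℝ} (hf : ComputableRealFunSeq f)
    (hg : ComputableRealFunSeq g) {B C : ℕ → ℕ} (hB : Computable B) (hC : Computable C)
    (hfB : ∀ n x, |f n x| ≤ B n) (hgC : ∀ n x, |g n x| ≤ C n) :
    ComputableRealFunSeq fun n x => f n x * g n x :=
  ⟨fun x hx => (hf.sequentially_computable x hx).mul (hg.sequentially_computable x hx),
    hf.effectively_continuous.mul hg.effectively_continuous hB hC hfB hgC⟩

theorem ComputableComplexFunSeq.re {φ : ℕ → ℝ → ℂ} (hφ : ComputableComplexFunSeq φ) :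
    ComputableRealFunSeq fun n x => (φ n x).re := by
  obtain ⟨hseq, α, hα, h⟩ := hφ
  exact ⟨fun x hx => (computableComplexSeq_iff.1 (hseq x hx)).1, α, hα,
    fun n L k x y hxy hx hy => by
      simpa using (Complex.abs_re_le_norm _).trans_lt (h n L k x y hxy hx hy)⟩

theorem ComputableComplexFunSeq.im {φ : ℕ → ℝ → ℂ} (hφ : ComputableComplexFunSeq φ) :
    ComputableRealFunSeq fun n x => (φ n x).im := by
  obtain ⟨hseq, α, hα, h⟩ := hφ
  exact ⟨fun x hx => (computableComplexSeq_iff.1 (hseq x hx)).2, α, hα,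
    fun n L k x y hxy hx hy => by
      simpa using (Complex.abs_im_le_norm _).trans_lt (h n L k x y hxy hx hy)⟩

end ComputableRealFunSeq

section Cutoff

open Filter Topology

/-- The continuous piecewise linear function that is `1` on `[-n, n]` and vanishes outside
`[-(n + 1), n + 1]`; for `n = 0` this is the triangle function supported in `[-1, 1]`. -/
noncomputable def cutoff (n : ℕ) (t : ℝ) : ℝ := max 0 (min 1 (n + 1 - |t|))

theorem cutoff_nonneg (n : ℕ) (t : ℝ) : 0 ≤ cutoff n t := le_max_left _ _

theorem cutoff_le_one (n : ℕ) (t : ℝ) : cutoff n t ≤ 1 := max_le zero_le_one (min_le_left _ _)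

theorem abs_cutoff_le_one (n : ℕ) (t : ℝ) : |cutoff n t| ≤ 1 :=
  (abs_of_nonneg (cutoff_nonneg n t)).trans_le (cutoff_le_one n t)

theorem cutoff_eq_one {n : ℕ} {t : ℝ} (h : |t| ≤ n) : cutoff n t = 1 := by
  rw [cutoff, min_eq_left (by linarith), max_eq_right zero_le_one]

theorem cutoff_eq_zero {n : ℕ} {t : ℝ} (h : n + 1 ≤ |t|) : cutoff n t = 0 := by
  rw [cutoff, max_eq_left ((min_le_right _ _).trans (by linarith))]

@[fun_prop]
theorem continuous_cutoff (n : ℕ) : Continuous (cutoff n) := by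
  unfold cutoff
  fun_prop

theorem abs_cutoff_sub_cutoff_le (n : ℕ) (s t : ℝ) : |cutoff n s - cutoff n t| ≤ |s - t| := by
  calc |cutoff n s - cutoff n t|
      ≤ |min 1 (n + 1 - |s|) - min 1 (n + 1 - |t|)| := by
        simpa only [cutoff, max_comm] using abs_max_sub_max_le_abs
          (min 1 ((n : ℝ) + 1 - |s|)) (min 1 ((n : ℝ) + 1 - |t|)) 0
    _ ≤ |(n + 1 - |s|) - (n + 1 - |t|)| := by
        simpa using abs_min_sub_min_le_max 1 ((n : ℝ) + 1 - |s|) 1 (n + 1 - |t|)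
    _ = |(|t| - |s|)| := by rw [sub_sub_sub_cancel_left]
    _ ≤ |s - t| := (abs_abs_sub_abs_le_abs_sub t s).trans_eq (abs_sub_comm t s)

theorem computableRealFunSeq_cutoff : ComputableRealFunSeq cutoff :=
  ⟨fun x hx => by unfold cutoff; fun_prop, .of_lipschitz (Computable.const 1) fun n s t => by
    simpa using abs_cutoff_sub_cutoff_le n s t⟩

theorem integrable_cutoff_comp (μ : Measure ℝ) [IsFiniteMeasure μ] (n : ℕ) {g : ℝ → ℝ}
    (hg : Continuous g) : Integrable (fun x => cutoff n (g x)) μ :=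
  .of_bound (by fun_prop) 1 (.of_forall fun _ => abs_cutoff_le_one n _)

theorem tendsto_integral_cutoff (μ : Measure ℝ) [IsProbabilityMeasure μ] :
    Tendsto (fun n => ∫ t, cutoff n t ∂μ) atTop (𝓝 1) := by
  have h : Tendsto (fun n => ∫ t, cutoff n t ∂μ) atTop (𝓝 (∫ _, (1 : ℝ) ∂μ)) := by
    refine tendsto_integral_of_dominated_convergence (fun _ => 1)
      (fun n => (continuous_cutoff n).aestronglyMeasurable) (integrable_const _)
      (fun n => .of_forall fun t => abs_cutoff_le_one n t) (.of_forall fun t => ?_)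
    refine tendsto_const_nhds.congr' ?_
    obtain ⟨N, hN⟩ := exists_nat_ge |t|
    filter_upwards [eventually_ge_atTop N] with n hn
    exact (cutoff_eq_one (hN.trans (by exact_mod_cast hn))).symm
  simpa using h

theorem measurableSet_lt_abs (T : ℝ) : MeasurableSet {x : ℝ | T < |x|} :=
  measurableSet_lt measurable_const (by fun_prop)

theorem measureReal_lt_abs_le_one_sub_integral_cutoff (μ : Measure ℝ) [IsProbabilityMeasure μ]
    (n : ℕ) : μ.real {x | (n + 1 : ℝ) < |x|} ≤ 1 - ∫ x, cutoff n x ∂μ := by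
  have hs := measurableSet_lt_abs (n + 1)
  have hint : Integrable (cutoff n) μ := integrable_cutoff_comp μ n continuous_id
  calc μ.real {x | (n + 1 : ℝ) < |x|}
      = ∫ x, {x : ℝ | (n + 1 : ℝ) < |x|}.indicator 1 x ∂μ := (integral_indicator_one hs).symm
    _ ≤ ∫ x, (1 - cutoff n x) ∂μ := by
        refine integral_mono ((integrable_const 1).indicator hs)
          ((integrable_const _).sub hint) fun x => ?_
        refine Set.indicator_apply_le' (fun hx => ?_) fun _ => sub_nonneg.2 (cutoff_le_one n x)
        rw [cutoff_eq_zero (le_of_lt hx), sub_zero, Pi.one_apply]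
    _ = 1 - ∫ x, cutoff n x ∂μ := by
        rw [integral_sub (integrable_const _) hint]
        simp

end Cutoff

section EffectivelyTight

variable {μ : ℕ → ProbabilityMeasure ℝ}

/-- Effective tightness of a sequence of probability measures on `ℝ`: the mass of `μ m` outside
`[-T, T]` is at most `2⁻ⁿ` for a recursive `T = T (m, n)`. -/
def EffectivelyTight (μ : ℕ → ProbabilityMeasure ℝ) : Prop :=
  ∃ T : ℕ × ℕ → ℕ, Computable T ∧
    ∀ m n, (μ m : Measure ℝ).real {x | (T (m, n) : ℝ) < |x|} ≤ 2⁻¹ ^ n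

theorem norm_integral_sub_integral_le {α E : Type*} [MeasurableSpace α] [NormedAddCommGroup E]
    [NormedSpace ℝ E] {ν : Measure α} [IsProbabilityMeasure ν] {f g : α → E} {s : Set α} {ε B : ℝ}
    (hf : Integrable f ν) (hg : Integrable g ν) (hs : MeasurableSet s) (hε : 0 ≤ ε)
    (h : ∀ x ∉ s, ‖f x - g x‖ ≤ ε) (hB : ∀ x, ‖f x - g x‖ ≤ B) :
    ‖∫ x, f x ∂ν - ∫ x, g x ∂ν‖ ≤ ε + B * ν.real s := by
  have hind : Integrable (s.indicator fun _ => B) ν := (integrable_const _).indicator hs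
  rw [← integral_sub hf hg]
  calc _ ≤ ∫ x, (ε + s.indicator (fun _ => B) x) ∂ν := by
        refine norm_integral_le_of_norm_le ((integrable_const _).add hind) (.of_forall fun x => ?_)
        by_cases hx : x ∈ s
        · rw [Set.indicator_of_mem hx]
          linarith [hB x]
        · rw [Set.indicator_of_notMem hx, add_zero]
          exact h x hx
    _ = ε + B * ν.real s := by
        rw [integral_add (integrable_const _) hind, integral_indicator_const _ hs]
        simp [mul_comm]

theorem ComputableDistributionSeq.effectivelyTight (hμ : ComputableDistributionSeq μ) :
    EffectivelyTight μ := by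
  have hcutoff : ComputableRealSeq fun p : ℕ × ℕ => 1 - ∫ x, cutoff p.2 x ∂(μ p.1 : Measure ℝ) :=
    .sub (by fun_prop) (hμ cutoff (· + 1) ⟨computableRealFunSeq_cutoff, by fun_prop,
      fun n x h => cutoff_eq_zero (by exact_mod_cast h)⟩)
  obtain ⟨c, hc, h⟩ := hcutoff.exists_lt_inv_two_pow fun m => by
    simpa using (tendsto_integral_cutoff (μ m : Measure ℝ)).const_sub 1
  refine ⟨fun i => c i + 1, by fun_prop, fun m n => ?_⟩
  push_cast
  exact (measureReal_lt_abs_le_one_sub_integral_cutoff _ _).trans (h m n).le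

theorem abs_integral_mul_cutoff_sub_le (ν : Measure ℝ) [IsProbabilityMeasure ν] {g : ℝ → ℝ} {B : ℝ}
    (hg : Continuous g) (hB : ∀ x, |g x| ≤ B) (n : ℕ) :
    |∫ x, g x * cutoff n x ∂ν - ∫ x, g x ∂ν| ≤ B * ν.real {x | (n : ℝ) < |x|} := by
  have hint : Integrable g ν := .of_bound hg.aestronglyMeasurable B (.of_forall hB)
  have hdiff x : g x * cutoff n x - g x = g x * (cutoff n x - 1) := by ring
  have hcutoff x : |cutoff n x - 1| ≤ 1 :=
    abs_le.2 ⟨by linarith [cutoff_nonneg n x], by linarith [cutoff_le_one n x]⟩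
  simpa using norm_integral_sub_integral_le (hint.mul_bdd
      (continuous_cutoff n).aestronglyMeasurable (.of_forall (abs_cutoff_le_one n))) hint
    (measurableSet_lt_abs n) le_rfl (fun x hx => by simp [cutoff_eq_one (not_lt.1 hx)]) fun x => by
      rw [hdiff, norm_mul]
      exact (mul_le_of_le_one_right (norm_nonneg _) (hcutoff x)).trans (hB x)

theorem ComputableDistributionSeq.integral_of_bounded (hμ : ComputableDistributionSeq μ)
    {g : ℕ → ℝ → ℝ} (hg : ComputableRealFunSeq g) {B : ℕ → ℕ} (hB : Computable B)
    (hgB : ∀ n x, |g n x| ≤ B n) :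
    ComputableRealSeq fun p : ℕ × ℕ => ∫ x, g p.2 x ∂(μ p.1 : Measure ℝ) := by
  obtain ⟨T, hT, hTμ⟩ := hμ.effectivelyTight
  have hmul : ComputableRealFunSeq fun n x => g n.unpair.1 x * cutoff n.unpair.2 x :=
    (hg.comp (g := fun n => n.unpair.1) (by fun_prop)).mul
      (computableRealFunSeq_cutoff.comp (g := fun n => n.unpair.2) (by fun_prop))
      (B := fun n => B n.unpair.1) (C := fun _ => 1) (by fun_prop) (by fun_prop)
      (fun n => hgB n.unpair.1) fun n x => by simpa using abs_cutoff_le_one n.unpair.2 x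
  have hint := hμ _ (fun n => n.unpair.2 + 1) ⟨hmul, by fun_prop, fun n x h => by
    rw [cutoff_eq_zero (by exact_mod_cast h), mul_zero]⟩
  refine .of_limit (u := fun i : (ℕ × ℕ) × ℕ =>
      ∫ x, g i.1.2 x * cutoff (T (i.1.1, i.2)) x ∂(μ i.1.1 : Measure ℝ))
    (b := fun i => B i.1.2 * 2⁻¹ ^ i.2) ?_ (by fun_prop (disch := norm_num)) (fun p k => ?_)
    fun p => tendsto_const_mul_inv_two_pow (B p.2)
  · have hpair : Computable fun i : (ℕ × ℕ) × ℕ => (i.1.1, Nat.pair i.1.2 (T (i.1.1, i.2))) := by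
      fun_prop
    simpa using hint.comp hpair
  · exact (abs_integral_mul_cutoff_sub_le _ (hg.effectively_continuous.continuous p.2) (hgB p.2)
      _).trans (mul_le_mul_of_nonneg_left (hTμ p.1 k) (by positivity))

end EffectivelyTight

section CharFun

variable (ν : Measure ℝ) [IsProbabilityMeasure ν]

theorem integrable_exp_mul_I (t : ℝ) :
    Integrable (fun x : ℝ => Complex.exp (t * x * Complex.I)) ν :=
  .of_bound (by fun_prop) 1 (.of_forall fun x => by
    rw [← Complex.ofReal_mul, Complex.norm_exp_ofReal_mul_I])

theorem re_charFun (t : ℝ) : (charFun ν t).re = ∫ x, Real.cos (t * x) ∂ν := by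
  rw [charFun_apply_real, ← Complex.reCLM_apply,
    ← Complex.reCLM.integral_comp_comm (integrable_exp_mul_I ν t)]
  simp only [Complex.reCLM_apply, ← Complex.ofReal_mul, Complex.exp_ofReal_mul_I_re]

theorem im_charFun (t : ℝ) : (charFun ν t).im = ∫ x, Real.sin (t * x) ∂ν := by
  rw [charFun_apply_real, ← Complex.imCLM_apply,
    ← Complex.imCLM.integral_comp_comm (integrable_exp_mul_I ν t)]
  simp only [Complex.imCLM_apply, ← Complex.ofReal_mul, Complex.exp_ofReal_mul_I_im]

theorem norm_exp_mul_I_sub_le (s t x : ℝ) :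
    ‖Complex.exp (s * x * Complex.I) - Complex.exp (t * x * Complex.I)‖ ≤ |s - t| * |x| := by
  have hfactor : Complex.exp (s * x * Complex.I) - Complex.exp (t * x * Complex.I) =
      Complex.exp ((t * x : ℝ) * Complex.I) *
        (Complex.exp (Complex.I * ((s - t) * x : ℝ)) - 1) := by
    rw [mul_sub, ← Complex.exp_add]
    push_cast
    ring_nf
  rw [hfactor, norm_mul, Complex.norm_exp_ofReal_mul_I, one_mul, ← abs_mul]
  exact Real.norm_exp_I_mul_ofReal_sub_one_le

theorem norm_charFun_sub_le (s t : ℝ) {T : ℝ} (hT : 0 ≤ T) :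
    ‖charFun ν s - charFun ν t‖ ≤ |s - t| * T + 2 * ν.real {x | T < |x|} := by
  rw [charFun_apply_real, charFun_apply_real]
  refine norm_integral_sub_integral_le (integrable_exp_mul_I ν s) (integrable_exp_mul_I ν t)
    (measurableSet_lt_abs T) (by positivity) (fun x hx => ?_) fun x => ?_
  · exact (norm_exp_mul_I_sub_le s t x).trans (by gcongr; exact not_lt.1 hx)
  · refine (norm_sub_le _ _).trans_eq ?_
    rw [← Complex.ofReal_mul, ← Complex.ofReal_mul, Complex.norm_exp_ofReal_mul_I,
      Complex.norm_exp_ofReal_mul_I]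
    norm_num

variable {μ : ℕ → ProbabilityMeasure ℝ}

theorem EffectivelyTight.effectivelyContinuous_charFun (hμ : EffectivelyTight μ) :
    EffectivelyContinuous fun m t => charFun (μ m : Measure ℝ) t := by
  obtain ⟨T, hT, h⟩ := hμ
  refine ⟨fun p => p.2.2 + 2 + T (p.1, p.2.2 + 2), by fun_prop, fun m L k s t hst _ _ => ?_⟩
  have hnear : |s - t| * T (m, k + 2) ≤ 2⁻¹ ^ (k + 2) := by
    rw [mul_comm]
    exact (mul_le_mul_of_nonneg_left hst.le (by positivity)).trans
      (natCast_mul_inv_two_pow_le le_rfl)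
  calc _ ≤ |s - t| * T (m, k + 2) + 2 * (μ m : Measure ℝ).real {x | (T (m, k + 2) : ℝ) < |x|} :=
        norm_charFun_sub_le _ s t (by positivity)
    _ ≤ 2⁻¹ ^ (k + 2) + 2 * 2⁻¹ ^ (k + 2) := by
        gcongr
        exact h m (k + 2)
    _ < 2⁻¹ ^ (k + 2) + 3 * 2⁻¹ ^ (k + 2) := by
        gcongr
        norm_num
    _ = 2⁻¹ ^ k := by ring

theorem ComputableRealFunSeq.lipschitz_comp_mul {F : ℝ → ℝ}
    (hF : ∀ x : ℕ × ℕ → ℝ, ComputableRealSeq x → ComputableRealSeq fun i => F (x i))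
    (hlip : ∀ s t, |F s - F t| ≤ |s - t|) {x : ℕ → ℝ} (hx : ComputableRealSeq x) :
    ComputableRealFunSeq fun n t => F (x n * t) := by
  obtain ⟨B, hB, hxB⟩ := hx.exists_bound
  refine ⟨fun y hy => hF (fun p => x p.1 * y p.2) (by fun_prop), .of_lipschitz hB fun n s t => ?_⟩
  refine (hlip _ _).trans ?_
  rw [← mul_sub, abs_mul]
  gcongr
  exact hxB n

theorem ComputableDistributionSeq.computable_charFun (hμ : ComputableDistributionSeq μ) :
    ComputableComplexFunSeq fun m t => charFun (μ m : Measure ℝ) t := by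
  refine ⟨fun x hx => computableComplexSeq_iff.2 ⟨?_, ?_⟩,
    hμ.effectivelyTight.effectivelyContinuous_charFun⟩
  · simp only [re_charFun]
    exact hμ.integral_of_bounded (.lipschitz_comp_mul (fun _ h => h.cos) Real.abs_cos_sub_cos_le hx)
      (Computable.const 1) fun n t => by simpa using Real.abs_cos_le_one (x n * t)
  · simp only [im_charFun]
    exact hμ.integral_of_bounded (.lipschitz_comp_mul (fun _ h => h.sin) Real.abs_sin_sub_sin_le hx)
      (Computable.const 1) fun n t => by simpa using Real.abs_sin_le_one (x n * t)

end CharFun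

section TentPoly

open Filter Topology Real

theorem hasSum_cos_div_sq {y : ℝ} (hy : |y| ≤ 2 * π) :
    HasSum (fun n : ℕ => 1 / (n : ℝ) ^ 2 * cos (n * y)) (y ^ 2 / 4 - π * |y| / 2 + π ^ 2 / 6) := by
  have hx : |y| / (2 * π) ∈ Set.Icc (0 : ℝ) 1 :=
    ⟨by positivity, (div_le_one (by positivity)).2 hy⟩
  have h := hasSum_one_div_nat_pow_mul_cos one_ne_zero hx
  have hB : (Polynomial.map (algebraMap ℚ ℝ) (Polynomial.bernoulli 2)).eval (|y| / (2 * π)) =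
      (|y| / (2 * π)) ^ 2 - |y| / (2 * π) + 6⁻¹ := bernoulliFun_two _
  rw [mul_one, hB] at h
  convert h using 1
  · funext n
    have harg : 2 * π * n * (|y| / (2 * π)) = |n * y| := by
      rw [abs_mul, Nat.abs_cast]
      field_simp
    rw [harg, cos_abs]
  · rw [← sq_abs y]
    simp only [Nat.factorial]
    push_cast
    field_simp
    ring

/-- The `k`-th coefficient of the cosine polynomial `tentPoly a N`. -/
noncomputable def tentCoeff (a : ℝ) (k : ℕ) : ℝ :=
  2 * (1 - cos ((k + 1) * a)) / (π * a * (k + 1) ^ 2)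

/-- The partial sums of the Fourier series of the function of period `2 * π / a` that agrees with
the triangle function `cutoff 0` on `[-π / a, π / a]`. -/
noncomputable def tentPoly (a : ℝ) (N : ℕ) (u : ℝ) : ℝ :=
  a / (2 * π) + ∑ k ∈ Finset.range N, tentCoeff a k * cos ((k + 1) * a * u)

variable {a : ℝ}

theorem tentCoeff_nonneg (ha : 0 ≤ a) (k : ℕ) : 0 ≤ tentCoeff a k := by
  have hcos : 0 ≤ 1 - cos ((k + 1) * a) := sub_nonneg.2 (cos_le_one _)
  unfold tentCoeff
  positivity

theorem abs_tentCoeff_mul_cos_le (ha : 0 ≤ a) (k : ℕ) (t : ℝ) :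
    |tentCoeff a k * cos t| ≤ tentCoeff a k := by
  rw [abs_mul, abs_of_nonneg (tentCoeff_nonneg ha k)]
  exact mul_le_of_le_one_right (tentCoeff_nonneg ha k) (abs_cos_le_one _)

theorem tentCoeff_le (ha : 0 < a) (k : ℕ) : tentCoeff a k ≤ 4 / a * (((k + 1 : ℕ) : ℝ) ^ 2)⁻¹ := by
  have hcos : 2 * (1 - cos ((k + 1) * a)) ≤ 4 := by linarith [neg_one_le_cos ((k + 1) * a)]
  calc tentCoeff a k ≤ 4 / (1 * a * (k + 1) ^ 2) := by
        unfold tentCoeff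
        gcongr
        linarith [pi_gt_three]
    _ = 4 / a * (((k + 1 : ℕ) : ℝ) ^ 2)⁻¹ := by
        push_cast
        field_simp

theorem hasSum_tentCoeff_mul_cos (ha : 0 < a) (haπ : a ≤ π) {u : ℝ} (hu : |a * u| ≤ π) :
    HasSum (fun k : ℕ => tentCoeff a k * cos ((k + 1) * a * u)) (cutoff 0 u - a / (2 * π)) := by
  obtain ⟨hu1, hu2⟩ := abs_le.1 hu
  have hmid := hasSum_cos_div_sq (hu.trans (by linarith [pi_pos]))
  have hadd := hasSum_cos_div_sq (y := a * u + a) (abs_le.2 ⟨by linarith, by linarith⟩)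
  have hsub := hasSum_cos_div_sq (y := a * u - a) (abs_le.2 ⟨by linarith, by linarith⟩)
  -- The triangle function is a second difference of `|·|`.
  have habs : |a * u + a| + |a * u - a| = 2 * |a * u| + 2 * (a * cutoff 0 u) := by
    have h1 : |u + 1| + |u - 1| = 2 * |u| + 2 * cutoff 0 u := by
      unfold cutoff
      grind
    rw [← mul_add_one, ← mul_sub_one, abs_mul, abs_mul, abs_mul, abs_of_pos ha]
    linear_combination a * h1
  have h := ((hasSum_nat_add_iff' 1).2 (((hmid.mul_left 2).sub hadd).sub hsub)).div_const (π * a)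
  convert! h using 1
  · funext k
    rw [Nat.cast_add_one, mul_add _ (a * u) a, mul_sub _ (a * u) a, cos_add, cos_sub, tentCoeff,
      mul_assoc _ a u]
    field_simp
    ring
  · rw [Finset.sum_range_one, Nat.cast_zero, eq_div_iff (by positivity)]
    have hconst : a / (2 * π) * (π * a) = a ^ 2 / 2 := by field_simp
    linear_combination -(π / 2) * habs - hconst

theorem abs_tentPoly_le_one (ha : 0 < a) (haπ : a ≤ π) (N : ℕ) (u : ℝ) : |tentPoly a N u| ≤ 1 := by
  have hsum : HasSum (tentCoeff a) (1 - a / (2 * π)) := by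
    simpa [cutoff_eq_one] using hasSum_tentCoeff_mul_cos ha haπ (u := 0) (by simpa using pi_pos.le)
  calc |tentPoly a N u|
      ≤ |a / (2 * π)| + ∑ k ∈ Finset.range N, |tentCoeff a k * cos ((k + 1) * a * u)| :=
        (abs_add_le _ _).trans (by gcongr; exact Finset.abs_sum_le_sum_abs _ _)
    _ ≤ a / (2 * π) + ∑ k ∈ Finset.range N, tentCoeff a k := by
        rw [abs_of_pos (by positivity)]
        gcongr
        exact abs_tentCoeff_mul_cos_le ha.le _ _
    _ ≤ a / (2 * π) + (1 - a / (2 * π)) := by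
        gcongr
        exact sum_le_hasSum _ (fun k _ => tentCoeff_nonneg ha.le k) hsum
    _ = 1 := add_sub_cancel _ _

theorem abs_sum_range_sub_le {u : ℕ → ℝ} {S C : ℝ} (hC : 0 ≤ C) (h : HasSum u S)
    (hu : ∀ k : ℕ, |u k| ≤ C * (((k + 1 : ℕ) : ℝ) ^ 2)⁻¹) {N : ℕ} (hN : N ≠ 0) :
    |∑ k ∈ Finset.range N, u k - S| ≤ C / N := by
  refine le_of_tendsto (h.tendsto_sum_nat.const_sub (∑ k ∈ Finset.range N, u k)).abs ?_
  filter_upwards [eventually_ge_atTop N] with n hn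
  rw [abs_sub_comm, ← Finset.sum_Ico_eq_sub _ hn]
  calc |∑ k ∈ Finset.Ico N n, u k| ≤ ∑ k ∈ Finset.Ico N n, C * (((k + 1 : ℕ) : ℝ) ^ 2)⁻¹ :=
        (Finset.abs_sum_le_sum_abs _ _).trans (Finset.sum_le_sum fun k _ => hu k)
    _ = C * ∑ k ∈ Finset.Ioc N n, ((k : ℝ) ^ 2)⁻¹ := by
        rw [← Finset.mul_sum, Finset.sum_Ico_add' (fun k : ℕ => ((k : ℝ) ^ 2)⁻¹) N n 1,
          Finset.Ico_add_one_add_one_eq_Ioc]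
    _ ≤ C * ((N : ℝ)⁻¹ - (n : ℝ)⁻¹) := by
        gcongr
        exact sum_Ioc_inv_sq_le_sub hN hn
    _ ≤ C * (N : ℝ)⁻¹ := by
        gcongr
        exact sub_le_self _ (by positivity)
    _ = C / N := rfl

theorem abs_tentPoly_sub_le (ha : 0 < a) (haπ : a ≤ π) {u : ℝ} (hu : |a * u| ≤ π) {N : ℕ}
    (hN : N ≠ 0) : |tentPoly a N u - cutoff 0 u| ≤ 4 / a / N := by
  have h := abs_sum_range_sub_le (by positivity) (hasSum_tentCoeff_mul_cos ha haπ hu)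
    (fun k => (abs_tentCoeff_mul_cos_le ha.le _ _).trans (tentCoeff_le ha k)) hN
  rwa [← sub_add, sub_add_eq_add_sub, add_comm] at h

@[fun_prop]
theorem continuous_tentPoly (a : ℝ) (N : ℕ) : Continuous (tentPoly a N) := by
  unfold tentPoly
  fun_prop

theorem integral_cos_mul_sub (ν : Measure ℝ) [IsProbabilityMeasure ν] (t b : ℝ) :
    ∫ x, cos (t * x - b) ∂ν = cos b * (charFun ν t).re + sin b * (charFun ν t).im := by
  have hcos : Integrable (fun x => cos (t * x)) ν :=
    .of_bound (by fun_prop) 1 (.of_forall fun x => abs_cos_le_one _)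
  have hsin : Integrable (fun x => sin (t * x)) ν :=
    .of_bound (by fun_prop) 1 (.of_forall fun x => abs_sin_le_one _)
  simp only [cos_sub]
  rw [integral_add (hcos.mul_const _) (hsin.mul_const _), integral_mul_const, integral_mul_const,
    re_charFun, im_charFun, mul_comm, mul_comm (sin b)]

theorem integral_tentPoly (ν : Measure ℝ) [IsProbabilityMeasure ν] (a s c : ℝ) (N : ℕ) :
    ∫ x, tentPoly a N (s * x - c) ∂ν = a / (2 * π) + ∑ k ∈ Finset.range N, tentCoeff a k *
      (cos ((k + 1) * a * c) * (charFun ν ((k + 1) * a * s)).re +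
        sin ((k + 1) * a * c) * (charFun ν ((k + 1) * a * s)).im) := by
  have hint (k : ℕ) :
      Integrable (fun x => tentCoeff a k * cos ((k + 1) * a * s * x - (k + 1) * a * c)) ν :=
    (Integrable.of_bound (by fun_prop) 1 (.of_forall fun x => abs_cos_le_one _)).const_mul _
  simp only [tentPoly, mul_sub, ← mul_assoc]
  rw [integral_add (integrable_const _) (integrable_finsetSum _ fun k _ => hint k),
    integral_finsetSum _ fun k _ => hint k]
  simp only [integral_const_mul, integral_cos_mul_sub]
  simp

theorem abs_integral_tentPoly_inv_sub_le (ν : Measure ℝ) [IsProbabilityMeasure ν] {R s c T : ℝ}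
    (hR : 1 ≤ R) (hT : ∀ x, |x| ≤ T → |s * x - c| ≤ R) {N : ℕ} (hN : N ≠ 0) :
    |∫ x, tentPoly R⁻¹ N (s * x - c) ∂ν - ∫ x, cutoff 0 (s * x - c) ∂ν| ≤
      4 * R / N + 2 * ν.real {x | T < |x|} := by
  have hR0 : 0 < R := one_pos.trans_le hR
  have ha : 0 < R⁻¹ := inv_pos.2 hR0
  have haπ : R⁻¹ ≤ π := (inv_le_one_of_one_le₀ hR).trans (by linarith [pi_gt_three])
  have hperiod (x : ℝ) (hx : |x| ≤ T) : |R⁻¹ * (s * x - c)| ≤ π := by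
    rw [abs_mul, abs_of_pos ha, inv_mul_eq_div]
    exact ((div_le_one hR0).2 (hT x hx)).trans (by linarith [pi_gt_three])
  have htent : Integrable (fun x => tentPoly R⁻¹ N (s * x - c)) ν :=
    .of_bound (by fun_prop) 1 (.of_forall fun x => abs_tentPoly_le_one ha haπ N _)
  refine norm_integral_sub_integral_le htent (integrable_cutoff_comp ν 0 (by fun_prop))
    (measurableSet_lt_abs T) (by positivity)
    (fun x hx => ?_) fun x => ?_
  · simpa using abs_tentPoly_sub_le ha haπ (hperiod x (not_lt.1 hx)) hN
  calc ‖tentPoly R⁻¹ N (s * x - c) - cutoff 0 (s * x - c)‖ ≤ 1 + 1 :=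
        norm_sub_le_of_le (abs_tentPoly_le_one ha haπ N _) (abs_cutoff_le_one 0 _)
    _ = 2 := one_add_one_eq_two

end TentPoly

section Tightness

variable {μ : ℕ → ProbabilityMeasure ℝ}

theorem measureReal_lt_abs_le_of_norm_charFun_sub_one_le (ν : Measure ℝ) [IsProbabilityMeasure ν]
    {r δ : ℝ} (hr : 0 < r) (h : ∀ t, |t| ≤ 2 * r⁻¹ → ‖charFun ν t - 1‖ ≤ δ) :
    ν.real {x | r < |x|} ≤ 2 * δ := by
  have hint : ‖∫ t in (-2 * r⁻¹)..(2 * r⁻¹), 1 - charFun ν t‖ ≤ δ * |2 * r⁻¹ - -2 * r⁻¹| := by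
    refine intervalIntegral.norm_integral_le_of_norm_le_const fun t ht => ?_
    rw [Set.uIoc_of_le (by linarith [inv_pos.2 hr])] at ht
    rw [norm_sub_rev]
    exact h t (abs_le.2 ⟨by linarith [ht.1], ht.2⟩)
  calc ν.real {x | r < |x|} ≤ 2⁻¹ * r * (δ * |2 * r⁻¹ - -2 * r⁻¹|) :=
        (measureReal_abs_gt_le_integral_charFun hr).trans (by gcongr)
    _ = 2 * δ := by
        rw [abs_of_pos (by linarith [inv_pos.2 hr])]
        field_simp
        ring

theorem EffectivelyContinuous.effectivelyTight_of_charFun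
    (hφ : EffectivelyContinuous fun m t => charFun (μ m : Measure ℝ) t) : EffectivelyTight μ := by
  obtain ⟨α, hα, h⟩ := hφ
  refine ⟨fun p => 2 ^ (α (p.1, 1, p.2 + 1) + 2), by fun_prop, fun m n => ?_⟩
  set d := α (m, 1, n + 1)
  have hr : 2 * (((2 ^ (d + 2) : ℕ) : ℝ))⁻¹ = 2⁻¹ ^ (d + 1) := by
    push_cast
    rw [← inv_pow, pow_succ]
    ring
  have hδ := measureReal_lt_abs_le_of_norm_charFun_sub_one_le (μ m : Measure ℝ)
    (r := (2 ^ (d + 2) : ℕ)) (δ := 2⁻¹ ^ (n + 1)) (by positivity) fun t ht => by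
      rw [hr] at ht
      have htd : |t - 0| < 2⁻¹ ^ d := by
        rw [sub_zero]
        exact ht.trans_lt (pow_lt_pow_right_of_lt_one₀ (by norm_num) (by norm_num) d.lt_succ_self)
      have ht1 : |t| ≤ (1 : ℕ) := by
        rw [Nat.cast_one]
        exact ht.trans (pow_le_one₀ (by norm_num) (by norm_num))
      simpa using (h m 1 (n + 1) t 0 htd ht1 (by simp)).le
  exact hδ.trans_eq (by ring)

end Tightness

section IntegralCutoff

open Real

variable {ι : Type*} [Primcodable ι] {μ : ℕ → ProbabilityMeasure ℝ}

theorem ComputableRealSeq.tentCoeff {a : ι → ℝ} (ha : ComputableRealSeq a) (ha0 : ∀ i, a i ≠ 0)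
    {k : ι → ℕ} (hk : Computable k) : ComputableRealSeq fun i => tentCoeff (a i) (k i) := by
  have hne i : π * a i * (k i + 1) ^ 2 ≠ 0 := by
    have := ha0 i
    positivity
  unfold PourElRichards.tentCoeff
  fun_prop (disch := exact hne)

theorem ComputableComplexFunSeq.integral_tentPoly
    (hφ : ComputableComplexFunSeq fun m t => charFun (μ m : Measure ℝ) t) {m N : ι → ℕ}
    (hm : Computable m) (hN : Computable N) {a s c : ι → ℝ} (ha : ComputableRealSeq a)
    (ha0 : ∀ i, a i ≠ 0) (hs : ComputableRealSeq s) (hc : ComputableRealSeq c) :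
    ComputableRealSeq fun i =>
      ∫ x, tentPoly (a i) (N i) (s i * x - c i) ∂(μ (m i) : Measure ℝ) := by
  have hcoeff := ComputableRealSeq.tentCoeff (a := fun p : ι × ℕ => a p.1) (by fun_prop)
    (fun p => ha0 p.1) (k := fun p => p.2) (by fun_prop)
  have hre := hφ.re.apply (n := fun p : ι × ℕ => m p.1) (by fun_prop)
    (x := fun p => (p.2 + 1) * a p.1 * s p.1) (by fun_prop)
  have him := hφ.im.apply (n := fun p : ι × ℕ => m p.1) (by fun_prop)
    (x := fun p => (p.2 + 1) * a p.1 * s p.1) (by fun_prop)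
  have hfreq : ComputableRealSeq fun p : ι × ℕ => (p.2 + 1) * a p.1 * c p.1 := by fun_prop
  simp only [PourElRichards.integral_tentPoly]
  exact .add (by fun_prop (disch := intro; positivity))
    (.sum_range (hcoeff.mul ((hfreq.cos.mul hre).add (hfreq.sin.mul him))) hN)

theorem ComputableComplexFunSeq.integral_cutoff
    (hφ : ComputableComplexFunSeq fun m t => charFun (μ m : Measure ℝ) t) {m : ι → ℕ}
    (hm : Computable m) {s c : ι → ℝ} (hs : ComputableRealSeq s) (hc : ComputableRealSeq c) :
    ComputableRealSeq fun i => ∫ x, cutoff 0 (s i * x - c i) ∂(μ (m i) : Measure ℝ) := by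
  obtain ⟨S, hS, hsS⟩ := hs.exists_bound
  obtain ⟨C, hC, hcC⟩ := hc.exists_bound
  obtain ⟨T, hT, hTμ⟩ := hφ.effectively_continuous.effectivelyTight_of_charFun
  -- `R i` bounds `|s i * x - c i|` on the interval `[-T i, T i]` carrying most of the mass.
  let R : ι × ℕ → ℕ := fun i => S i.1 * T (m i.1, i.2) + C i.1 + 1
  have hR : Computable R := by fun_prop
  have hR0 i : (0 : ℝ) < R i := by positivity
  refine .of_limit (u := fun i => ∫ x, tentPoly (R i : ℝ)⁻¹ (R i * 2 ^ i.2) (s i.1 * x - c i.1)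
      ∂(μ (m i.1) : Measure ℝ)) (b := fun i => 6 * 2⁻¹ ^ i.2)
    (hφ.integral_tentPoly (by fun_prop) (by fun_prop) (.inv (by fun_prop) fun i => (hR0 i).ne')
      (fun i => inv_ne_zero (hR0 i).ne') (by fun_prop) (by fun_prop))
    (by fun_prop (disch := norm_num)) (fun i n => ?_) fun _ => tendsto_const_mul_inv_two_pow 6
  · have hR_bound (x : ℝ) (hx : |x| ≤ T (m i, n)) : |s i * x - c i| ≤ R (i, n) := by
      calc |s i * x - c i| ≤ |s i| * |x| + |c i| := (abs_sub _ _).trans_eq (by rw [abs_mul])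
        _ ≤ S i * T (m i, n) + C i := by
            gcongr
            exacts [hsS i, hcC i]
        _ ≤ R (i, n) := by simp [R]
    calc _ ≤ 4 * (R (i, n) : ℝ) / (R (i, n) * 2 ^ n : ℕ) + 2 * 2⁻¹ ^ n := by
          refine (abs_integral_tentPoly_inv_sub_le _ (by exact_mod_cast hR0 (i, n)) hR_bound
            (by positivity)).trans ?_
          gcongr
          exact hTμ (m i) n
      _ = 6 * 2⁻¹ ^ n := by
          have := (hR0 (i, n)).ne'
          rw [inv_pow]
          push_cast
          field_simp
          norm_num

end IntegralCutoff

section Interpolant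

variable {μ : ℕ → ProbabilityMeasure ℝ}

theorem sum_range_cutoff_zero (v : ℝ) (n : ℕ) : ∑ j ∈ Finset.range n, cutoff 0 (v - j) =
    max 0 (min 1 (v + 1)) - max 0 (min 1 (v + 1 - n)) := by
  induction n with
  | zero => simp
  | succ n ih =>
    rw [Finset.sum_range_succ, ih]
    unfold cutoff
    push_cast
    grind

theorem abs_sum_mul_cutoff_sub_le {w : ℕ → ℝ} {v b ε : ℝ} {n : ℕ} (hε : 0 ≤ ε)
    (hb : b ≠ 0 → 0 ≤ v ∧ v + 1 ≤ n) (h : ∀ j < n, |v - j| < 1 → |w j - b| ≤ ε) :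
    |∑ j ∈ Finset.range n, w j * cutoff 0 (v - j) - b| ≤ ε := by
  have hsum := sum_range_cutoff_zero v n
  have hb1 : b * ∑ j ∈ Finset.range n, cutoff 0 (v - j) = b := by
    by_cases hb0 : b = 0
    · rw [hb0, zero_mul]
    · obtain ⟨hv, hvn⟩ := hb hb0
      have hv1 : (1 : ℝ) ≤ v + 1 := by linarith
      rw [hsum, min_eq_left hv1, max_eq_right zero_le_one,
        max_eq_left ((min_le_right _ _).trans (by linarith)), sub_zero, mul_one]
  calc |∑ j ∈ Finset.range n, w j * cutoff 0 (v - j) - b|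
      = |∑ j ∈ Finset.range n, (w j - b) * cutoff 0 (v - j)| := by
        simp only [sub_mul, Finset.sum_sub_distrib, ← Finset.mul_sum, hb1]
    _ ≤ ∑ j ∈ Finset.range n, ε * cutoff 0 (v - j) := by
        refine (Finset.abs_sum_le_sum_abs _ _).trans (Finset.sum_le_sum fun j hj => ?_)
        rw [abs_mul, abs_of_nonneg (cutoff_nonneg _ _)]
        rcases lt_or_ge |v - j| 1 with hlt | hge
        · exact mul_le_mul_of_nonneg_right (h j (Finset.mem_range.1 hj) hlt) (cutoff_nonneg _ _)
        · rw [cutoff_eq_zero (by simpa using hge), mul_zero, mul_zero]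
    _ ≤ ε * 1 := by
        rw [← Finset.mul_sum, hsum]
        gcongr
        grind
    _ = ε := mul_one ε

/-- The piecewise linear function that agrees with `f` at the points of `[-L, L]` in `2⁻ᵈ ℤ` and
vanishes at the other points of `2⁻ᵈ ℤ`. -/
noncomputable def interpolant (f : ℝ → ℝ) (L d : ℕ) (x : ℝ) : ℝ :=
  ∑ j ∈ Finset.range (2 * (L * 2 ^ d) + 1),
    f (j / 2 ^ d - L) * cutoff 0 (2 ^ d * x - (j - L * 2 ^ d))

theorem abs_interpolant_sub_le {f : ℝ → ℝ} {L d : ℕ} {ε : ℝ} (hε : 0 ≤ ε)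
    (hf : ∀ x y : ℝ, |x - y| < 2⁻¹ ^ d → |x| ≤ L + 1 → |y| ≤ L + 1 → |f x - f y| ≤ ε)
    (hfL : ∀ x : ℝ, L ≤ |x| → f x = 0) (x : ℝ) : |interpolant f L d x - f x| ≤ ε := by
  have hshift (j : ℕ) : 2 ^ d * x - (j - L * 2 ^ d) = 2 ^ d * (x + L) - j := by ring
  simp only [interpolant, hshift]
  refine abs_sum_mul_cutoff_sub_le hε (fun hx => ?_) fun j hj hlt => ?_
  · have hxL := abs_le.1 (lt_of_not_ge fun h => hx (hfL x h)).le
    have h2 : (0 : ℝ) < 2 ^ d := by positivity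
    push_cast
    constructor <;> nlinarith
  · set y : ℝ := j / 2 ^ d - L
    have hxy : |y - x| < 2⁻¹ ^ d := by
      have hscale : 2 ^ d * (x + L) - j = 2 ^ d * (x - y) := by
        simp only [y]
        field_simp
        ring
      rwa [hscale, abs_mul, abs_of_pos (by positivity), abs_sub_comm, ← lt_inv_mul_iff₀
        (by positivity), mul_one, ← inv_pow] at hlt
    have hy : |y| ≤ L := by
      have hj' : (j : ℝ) ≤ 2 * (L * 2 ^ d) := by exact_mod_cast Nat.lt_succ_iff.1 hj
      have hj2 : (j : ℝ) / 2 ^ d ≤ 2 * L := by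
        rw [div_le_iff₀ (by positivity)]
        linarith
      have hj0 : (0 : ℝ) ≤ j / 2 ^ d := by positivity
      exact abs_le.2 ⟨by linarith, by linarith⟩
    have hd1 : (2 : ℝ)⁻¹ ^ d ≤ 1 := pow_le_one₀ (by norm_num) (by norm_num)
    exact hf y x hxy (by linarith) (by linarith [abs_sub_abs_le_abs_sub x y, abs_sub_comm x y])

theorem integral_interpolant (ν : Measure ℝ) [IsFiniteMeasure ν] (f : ℝ → ℝ) (L d : ℕ) :
    ∫ x, interpolant f L d x ∂ν = ∑ j ∈ Finset.range (2 * (L * 2 ^ d) + 1),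
      f (j / 2 ^ d - L) * ∫ x, cutoff 0 (2 ^ d * x - (j - L * 2 ^ d)) ∂ν := by
  simp only [interpolant, ← integral_const_mul]
  exact integral_finsetSum _ fun j _ =>
    (integrable_cutoff_comp ν 0 (by fun_prop)).const_mul _

theorem abs_integral_interpolant_sub_le (ν : Measure ℝ) [IsProbabilityMeasure ν] {f : ℝ → ℝ}
    {L d : ℕ} {ε : ℝ} (hcont : Continuous f) (hε : 0 ≤ ε)
    (hf : ∀ x y : ℝ, |x - y| < 2⁻¹ ^ d → |x| ≤ L + 1 → |y| ≤ L + 1 → |f x - f y| ≤ ε)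
    (hfL : ∀ x : ℝ, L ≤ |x| → f x = 0) : |∫ x, interpolant f L d x ∂ν - ∫ x, f x ∂ν| ≤ ε := by
  have hfint : Integrable f ν := hcont.integrable_of_hasCompactSupport
    (.intro (isCompact_Icc (a := -(L : ℝ)) (b := L)) fun x hx =>
      hfL x (le_of_not_ge fun h => hx (abs_le.1 h)))
  have hint : Integrable (interpolant f L d) ν := integrable_finsetSum _ fun j _ =>
    (integrable_cutoff_comp ν 0 (by fun_prop)).const_mul _
  simpa using norm_integral_sub_integral_le hint hfint .empty hε
    (fun x _ => abs_interpolant_sub_le hε hf hfL x) (abs_interpolant_sub_le hε hf hfL)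

theorem ComputableComplexFunSeq.computableDistributionSeq
    (hφ : ComputableComplexFunSeq fun m t => charFun (μ m : Measure ℝ) t) :
    ComputableDistributionSeq μ := by
  rintro f L ⟨hf, hL, hfL⟩
  obtain ⟨α, hα, hfα⟩ := hf.effectively_continuous
  let d : (ℕ × ℕ) × ℕ → ℕ := fun i => α (i.1.2, L i.1.2 + 1, i.2)
  have hd : Computable d := by fun_prop
  have hnode := hf.apply (n := fun p : ((ℕ × ℕ) × ℕ) × ℕ => p.1.1.2) (by fun_prop)
    (x := fun p => p.2 / 2 ^ d p.1 - L p.1.1.2) (by fun_prop (disch := intro; positivity))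
  have hcutoff := hφ.integral_cutoff (m := fun p : ((ℕ × ℕ) × ℕ) × ℕ => p.1.1.1) (by fun_prop)
    (s := fun p => 2 ^ d p.1) (c := fun p => p.2 - L p.1.1.2 * 2 ^ d p.1) (by fun_prop)
    (by fun_prop)
  refine .of_limit (u := fun i => ∫ x, interpolant (f i.1.2) (L i.1.2) (d i) x
      ∂(μ i.1.1 : Measure ℝ)) (b := fun i => 2⁻¹ ^ i.2) ?_ (by fun_prop (disch := norm_num))
    (fun i k => ?_) fun _ => tendsto_pow_atTop_nhds_zero_of_lt_one (by norm_num) (by norm_num)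
  · simp only [integral_interpolant]
    exact .sum_range (hnode.mul hcutoff) (by fun_prop)
  · refine abs_integral_interpolant_sub_le _ (hf.effectively_continuous.continuous i.2)
      (by positivity) (fun x y hxy hx hy => ?_) (hfL i.2)
    exact (hfα i.2 (L i.2 + 1) k x y hxy (by exact_mod_cast hx) (by exact_mod_cast hy)).le

end Interpolant

end PourElRichards

theorem theorem4p6 (μ : ℕ → ProbabilityMeasure ℝ) :
    PourElRichards.ComputableDistributionSeq μ ↔
      PourElRichards.ComputableComplexFunSeq (fun m t => charFun (μ m : Measure ℝ) t) :=
  ⟨PourElRichards.ComputableDistributionSeq.computable_charFun,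
    PourElRichards.ComputableComplexFunSeq.computableDistributionSeq⟩
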